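/- Let $L=L(p_1,\dots,p_n)$, $n\ge 1$, $p_k\in\mathbb Z$, be the $n$-pretzel link given by its standard diagram: $n$ vertical twist boxes in a row, the $k$-th with $|p_k|$ crossings (half twists), the two right ends of each box being joined to the two left ends of the next one, cyclically. For $p_k>0$ the over-strands in the box run from bottom left to top right. Suppose that at least one $p_k$ is even, and let $L$ be equipped with any orientation. We say that $L$ moves in the opposite directions in a box if one of the two strands of the box is directed upwards and the other one downwards, and in the same direction if both are directed upwards or both downwards. Let $p_{e_1},\dots,p_{e_s}$, $p_{e_i}=2l_i$, be the even and $p_{o_1},\dots,p_{o_{n-s}}$ the odd ones among the $p_k$, numbered so that $L$ moves in the opposite directions in the boxes of $p_{e_1},\dots,p_{e_t}$ and in the same direction in the boxes of $p_{e_{t+1}},\dots,p_{e_s}$; assume that $p_{e_i}\neq 0$ for $i>t$. Let $$\alpha=\sum_{j=1}^{n-s}\operatorname{sign}(p_{o_j}),\qquad \beta=\sum_{i=t+1}^{s}\operatorname{sign}(p_{e_i}),\qquad p'=\operatorname{sign}(p)\,(|p|-1).$$ Let $\nabla$ denote the Conway polynomial, the invariant of oriented links with value $1$ on the unknot and $\nabla_{L_+}-\nabla_{L_-}=z\nabla_{L_0}$,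 and let $\nabla_m$ be the Conway polynomial of the torus link $T_{(2,m)}$, the closure of the $2$-braid $\sigma_1^m$ with parallel strands and positive crossings for $m>0$. Then $\nabla_m\ne 0$ for $m\neq 0$, and $$\nabla_L=\Big[\prod_{i=1}^{t}(-l_i)\Big]z^{t}\,\Pi\,\Big[\frac{\alpha+\beta}{2}z+\sum_{i=t+1}^{s}\frac{\nabla_{p_{e_i}'}}{\nabla_{p_{e_i}}}+\sum_{j=1}^{n-s}\frac{\nabla_{p_{o_j}'}}{\nabla_{p_{o_j}}}\Big]+\Big[\sum_{i=1}^{t}\ \prod_{1\le j\le t,\ j\ne i}(-l_j)\Big]z^{t-1}\,\Pi,$$ where $\Pi=\prod_{j=1}^{n-s}\nabla_{p_{o_j}}\prod_{i=t+1}^{s}\nabla_{p_{e_i}}$, and the second summand is $0$ if $t=0$. -/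

import Mathlib

open Polynomial

/-! ### Oriented link diagrams

A link diagram in the plane, in general position with respect to the height function, is read from
bottom to top and cut into horizontal slices, each containing one local minimum, one local maximum
or one crossing, and otherwise vertical strands only. -/

namespace LinkDiagram

/-- The non-trivial part of a slice.  `cup up` is a local minimum, oriented so that its left end
points up if and only if `up = true` (its right end then points down).  `cap` is a local maximum.
`cross b` is a crossing of two adjacent strands; for `b = true` the over-strand is the one that
joins bottom left to top right, for `b = false` it is the one that joins bottom right to
top left. -/
inductive Gen where
  | cup (up : Bool)
  | cap
  | cross (b : Bool)

/-- Number of strands entering a generator from below. -/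
def Gen.inp : Gen → ℕ
  | .cup _ => 0
  | .cap => 2
  | .cross _ => 2

/-- Number of strands leaving a generator above. -/
def Gen.out : Gen → ℕ
  | .cup _ => 2
  | .cap => 0
  | .cross _ => 2

/-- A slice: a generator with `left` vertical strands to its left. -/
structure Slice where
  left : ℕ
  gen : Gen

/-- The effect of a slice on the list (from left to right) of the directions of the strands,
`true` for up and `false` for down; `none` if the slice does not fit.  The two strands that meet
in a local maximum must have opposite directions. -/
def Slice.act : Slice → List Bool → Option (List Bool)
  | ⟨i, .cup c⟩, σ => if i ≤ σ.length then some (σ.take i ++ c :: (!c) :: σ.drop i) else none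
  | ⟨i, .cap⟩, σ =>
      match σ.drop i with
      | a :: b :: τ => if a = b then none else some (σ.take i ++ τ)
      | _ => none
  | ⟨i, .cross _⟩, σ =>
      match σ.drop i with
      | a :: b :: τ => some (σ.take i ++ b :: a :: τ)
      | _ => none

/-- The effect of a sequence of slices, read from bottom to top. -/
def run : List Slice → List Bool → Option (List Bool)
  | [], σ => some σ
  | s :: w, σ => (s.act σ).bind (run w)

/-- A sequence of slices is closed if it fits together to an oriented diagram without endpoints. -/
def Closed (w : List Slice) : Prop := run w [] = some []

end LinkDiagram

open LinkDiagram in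
/-- An oriented link diagram. -/
structure LinkDiagram where
  word : List Slice
  closed : Closed word

namespace LinkDiagram

/-- The elementary local moves: planar isotopy (exchange of distant slices, cancellation of a
minimum against a maximum, sliding a strand past a minimum or maximum) and the
three Reidemeister moves. -/
inductive LocalMove : List Slice → List Slice → Prop
  | exchange (g h : Gen) (i j : ℕ) (hij : i ≤ j) :
      LocalMove [⟨i, g⟩, ⟨j + g.out, h⟩] [⟨j + g.inp, h⟩, ⟨i, g⟩]
  | zigzag (i : ℕ) (c : Bool) : LocalMove [⟨i, .cup c⟩, ⟨i + 1, .cap⟩] []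
  | zagzig (i : ℕ) (c : Bool) : LocalMove [⟨i + 1, .cup c⟩, ⟨i, .cap⟩] []
  | slideCup (i : ℕ) (b c : Bool) :
      LocalMove [⟨i, .cup c⟩, ⟨i + 1, .cross b⟩] [⟨i + 1, .cup c⟩, ⟨i, .cross (!b)⟩]
  | slideCap (i : ℕ) (b : Bool) :
      LocalMove [⟨i + 1, .cross b⟩, ⟨i, .cap⟩] [⟨i, .cross (!b)⟩, ⟨i + 1, .cap⟩]
  | reidemeisterOneCup (i : ℕ) (b c : Bool) :
      LocalMove [⟨i, .cup c⟩, ⟨i, .cross b⟩] [⟨i, .cup (!c)⟩]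
  | reidemeisterOneCap (i : ℕ) (b : Bool) :
      LocalMove [⟨i, .cross b⟩, ⟨i, .cap⟩] [⟨i, .cap⟩]
  | reidemeisterTwo (i : ℕ) (b : Bool) :
      LocalMove [⟨i, .cross b⟩, ⟨i, .cross (!b)⟩] []
  | reidemeisterThree (i : ℕ) (b : Bool) :
      LocalMove [⟨i, .cross b⟩, ⟨i + 1, .cross b⟩, ⟨i, .cross b⟩]
        [⟨i + 1, .cross b⟩, ⟨i, .cross b⟩, ⟨i + 1, .cross b⟩]

/-- `D'` arises from `D` by one local move.  Since `D` and `D'` are oriented diagrams that agree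
outside the place of the move, the move respects orientations. -/
def Move (D D' : LinkDiagram) : Prop :=
  ∃ u v a b : List Slice, LocalMove a b ∧ D.word = u ++ a ++ v ∧ D'.word = u ++ b ++ v

/-- Two diagrams represent the same oriented link. -/
def Isotopic : LinkDiagram → LinkDiagram → Prop := Relation.EqvGen Move

/-- The diagrams `Dp`, `Dm`, `D₀` agree except at one place, where `Dp` has a positive crossing,
`Dm` a negative crossing, and `D₀` the smoothing that respects the orientation.  Here `a`, `a'` are
the directions of the left and the right strand just below this place.  If both strands point up,
or both down, then the crossing whose over-strand runs from bottom left to top right is positive and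
the smoothing consists of two vertical strands.  If one points up and the other one down, then
that crossing is negative and the smoothing is a maximum below a minimum. -/
def SkeinTriple (Dp Dm D₀ : LinkDiagram) : Prop :=
  ∃ (u v : List Slice) (i : ℕ) (σ : List Bool) (a a' : Bool),
    run u [] = some σ ∧ σ[i]? = some a ∧ σ[i + 1]? = some a' ∧
    Dp.word = u ++ [⟨i, .cross (a == a')⟩] ++ v ∧
    Dm.word = u ++ [⟨i, .cross (a != a')⟩] ++ v ∧
    D₀.word = u ++ (if a = a' then [] else [⟨i, .cap⟩, ⟨i, .cup a'⟩]) ++ v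

/-- The diagram of the unknot without crossings. -/
def unknot : LinkDiagram := ⟨[⟨0, .cup true⟩, ⟨0, .cap⟩], by simp [Closed, run, Slice.act]⟩

/-- `HasConway D P` means that `P` is the Conway polynomial (in the variable `z = X`) of the
oriented link represented by `D`: the polynomial computed from the rules that it is an isotopy
invariant, that it is `1` for the unknot, and that `∇(Dp) - ∇(Dm) = z ∇(D₀)` for every skein
triple, where any two of the three polynomials determine the third one. -/
inductive HasConway : LinkDiagram → ℤ[X] → Prop
  | unknot : HasConway unknot 1
  | isotopy {D D' : LinkDiagram} {P : ℤ[X]} :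
      Isotopic D D' → HasConway D P → HasConway D' P
  | skein_pos {Dp Dm D₀ : LinkDiagram} {Pp Pm P₀ : ℤ[X]} :
      SkeinTriple Dp Dm D₀ → Pp - Pm = X * P₀ →
      HasConway Dm Pm → HasConway D₀ P₀ → HasConway Dp Pp
  | skein_neg {Dp Dm D₀ : LinkDiagram} {Pp Pm P₀ : ℤ[X]} :
      SkeinTriple Dp Dm D₀ → Pp - Pm = X * P₀ →
      HasConway Dp Pp → HasConway D₀ P₀ → HasConway Dm Pm
  | skein_zero {Dp Dm D₀ : LinkDiagram} {Pp Pm P₀ : ℤ[X]} :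
      SkeinTriple Dp Dm D₀ → Pp - Pm = X * P₀ →
      HasConway Dp Pp → HasConway Dm Pm → HasConway D₀ P₀

/-! ### Torus links and pretzel links -/

/-- A vertical twist of `|p|` crossings of the strands number `i` and `i + 1`; for `p > 0` the
over-strands run from bottom left to top right. -/
def twist (i : ℕ) (p : ℤ) : List Slice := List.replicate p.natAbs ⟨i, .cross (decide (0 < p))⟩

/-- The closure of the braid `σ₁ ^ m` on two strands, both directed upwards in the braid. -/
def torusWord (m : ℤ) : List Slice :=
  [⟨0, .cup true⟩, ⟨1, .cup true⟩] ++ twist 0 m ++ [⟨1, .cap⟩, ⟨0, .cap⟩]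

theorem closed_torusWord (m : ℤ) : Closed (torusWord m) := by
  have h : ∀ k b, run (List.replicate k ⟨0, .cross b⟩ ++ [⟨1, .cap⟩, ⟨0, .cap⟩])
      [true, true, false, false] = some [] := by
    intro k b
    induction k with
    | zero => simp [run, Slice.act]
    | succ k ih => simpa [List.replicate_succ, run, Slice.act] using ih
  simpa [Closed, torusWord, twist, run, Slice.act] using h m.natAbs (decide (0 < m))

/-- The oriented torus link `T(2, m)`: its two strands are parallel, and all crossings are
positive for `m > 0` and negative for `m < 0`. -/
def torusLink (m : ℤ) : LinkDiagram := ⟨torusWord m, closed_torusWord m⟩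

/-- The standard diagram of the pretzel link `L(p₀, …, pₙ₋₁)`: from left to right `n` boxes, the
`k`-th one being a vertical twist of `|p k|` crossings; the right ends of each box are joined to the
left ends of the next box by a bottom arc and a top arc, and the right ends of the last box to the
left ends of the first box by an outer bottom arc and an outer top arc.

`d` encodes the orientation: `d k = true` if the bottom arc that joins box `k - 1` to box `k`
(indices mod `n`) is directed from box `k` to box `k - 1`, that is, if it points up at its end at box
`k - 1`.  Every component runs through a bottom arc, so the orientations of the link are exactly
the `d` for which the word is closed. -/
def pretzelWord {n : ℕ} [NeZero n] (p : Fin n → ℤ) (d : Fin n → Bool) : List Slice :=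
  [⟨0, .cup (!(d 0))⟩] ++
  (List.finRange n).tail.map (fun k : Fin n => ⟨2 * (k : ℕ) - 1, .cup (d k)⟩) ++
  (List.finRange n).flatMap (fun k : Fin n => twist (2 * (k : ℕ)) (p k)) ++
  List.replicate (n - 1) ⟨1, .cap⟩ ++ [⟨0, .cap⟩]

/-- The oriented pretzel link with an orientation `d`. -/
def pretzelLink {n : ℕ} [NeZero n] (p : Fin n → ℤ) (d : Fin n → Bool)
    (hd : Closed (pretzelWord p d)) : LinkDiagram := ⟨pretzelWord p d, hd⟩

/-- The two strands of box `k` run in opposite directions: one upwards and one downwards.  At the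
bottom of box `k`, the left strand points up iff `d k = false`, and the right strand points up
iff `d (k + 1) = true` (with `k + 1` taken mod `n`). -/
def IsOpposite {n : ℕ} [NeZero n] (d : Fin n → Bool) (k : Fin n) : Prop := (!(d k)) ≠ d (k + 1)

instance {n : ℕ} [NeZero n] (d : Fin n → Bool) (k : Fin n) : Decidable (IsOpposite d k) :=
  inferInstanceAs (Decidable ((!(d k)) ≠ d (k + 1)))

/-- `p' = sign(p) (|p| - 1)`. -/
def shrink (p : ℤ) : ℤ := p.sign * (|p| - 1)

/-- The indices of the even boxes in which the link moves in opposite directions. -/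
def evenOpp {n : ℕ} [NeZero n] (p : Fin n → ℤ) (d : Fin n → Bool) : Finset (Fin n) :=
  Finset.univ.filter (fun k => Even (p k) ∧ IsOpposite d k)

/-- The indices of the even boxes in which the link moves in the same direction. -/
def evenSame {n : ℕ} [NeZero n] (p : Fin n → ℤ) (d : Fin n → Bool) : Finset (Fin n) :=
  Finset.univ.filter (fun k => Even (p k) ∧ ¬ IsOpposite d k)

/-- The indices of the odd boxes. -/
def oddBoxes {n : ℕ} (p : Fin n → ℤ) : Finset (Fin n) :=
  Finset.univ.filter (fun k => Odd (p k))

end LinkDiagram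

namespace LinkDiagram

/-! ### Runs -/

/-! The pretzel diagram is isotopic to the closure of a chain of tangles, one per box, acting on the
middle two of four strands (`exists_tangleIso_closed_chainWord`). Inside its tangle a box is turned
by a right angle: deleting its crossings leaves a maximum below a minimum (call it ε), while putting
ε in its place leaves vertical strands.

If there is an even box, closedness forces the middle strands to be antiparallel between any two
tangles, and every box with antiparallel strands to be even. By the skein relation such a box with
2l crossings is -lz·id + ε. A parallel box with p crossings is ∇_p·σ + ∇_{p-1}·ε, where σ is one
crossing; here ∇_p is a Fibonacci polynomial, continued to negative p by its recursion.

Crossings next to ε are removed by Reidemeister I, and ε·ε = 0 because it contains a split circle.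
With f the coefficient of id or σ and g that of ε, the chain is therefore ∏f times a power of σ,
plus (∑ g_i ∏_{k≠i} f_k)·ε, as for dual numbers (`conway_chainWord`). The number of parallel boxes
is even, say 2j. The closure of σ^{2j} has polynomial jz, and that of ε is an unknot
(`conway_closed_replicate`).

It remains to replace ∇_{p-1} by ∇_{p'}. This adds (sign p - 1)z/2 to each quotient g/f of a
parallel box (`torusPoly_sub_one`), in total (α+β)z/2 - jz, and -jz cancels the first term. The
antiparallel boxes, with f = -lz and g = 1, give the second summand (`pretzel_sum_eq`). -/

theorem run_append (u v : List Slice) (σ : List Bool) :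
    run (u ++ v) σ = (run u σ).bind (run v) := by
  induction u generalizing σ with
  | nil => rfl
  | cons s u ih =>
    simp only [List.cons_append, run, Option.bind_assoc]
    congr 1
    funext τ
    exact ih τ

theorem run_append_of_eq {u : List Slice} {σ τ : List Bool} (h : run u σ = some τ)
    (v : List Slice) : run (u ++ v) σ = run v τ := by
  rw [run_append, h]; rfl

/-- The directions of the strands at the two ends of a generator. -/
inductive Gen.Acts : Gen → List Bool → List Bool → Prop
  | cup (c : Bool) : Acts (.cup c) [] [c, !c]
  | cap (a : Bool) : Acts .cap [a, !a] []
  | cross (b a a' : Bool) : Acts (.cross b) [a, a'] [a', a]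

theorem Gen.Acts.length_inp {g : Gen} {s s' : List Bool} (h : g.Acts s s') :
    s.length = g.inp := by cases h <;> rfl

theorem Gen.Acts.length_out {g : Gen} {s s' : List Bool} (h : g.Acts s s') :
    s'.length = g.out := by cases h <;> rfl

theorem act_cup (A B : List Bool) (c : Bool) :
    Slice.act ⟨A.length, .cup c⟩ (A ++ B) = some (A ++ c :: (!c) :: B) := by
  simp [Slice.act]

theorem act_cap (A B : List Bool) (a : Bool) :
    Slice.act ⟨A.length, .cap⟩ (A ++ a :: (!a) :: B) = some (A ++ B) := by
  simp [Slice.act]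

theorem act_cross (A B : List Bool) (b a a' : Bool) :
    Slice.act ⟨A.length, .cross b⟩ (A ++ a :: a' :: B) = some (A ++ a' :: a :: B) := by
  simp [Slice.act]

/-- Replaces the index arithmetic of `take` and `drop` by a splitting of the list, so that commuting
distant slices becomes a comparison of two splittings. -/
theorem act_eq_some_iff {i : ℕ} {g : Gen} {σ τ : List Bool} :
    Slice.act ⟨i, g⟩ σ = some τ ↔ ∃ A s s' B, A.length = i ∧ g.Acts s s' ∧
      σ = A ++ (s ++ B) ∧ τ = A ++ (s' ++ B) := by
  constructor
  · intro h
    cases g with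
    | cup c =>
      simp only [Slice.act] at h
      split_ifs at h with hi
      refine ⟨σ.take i, [], [c, !c], σ.drop i, by simpa using hi, .cup c, by simp, ?_⟩
      simpa using h.symm
    | cap =>
      simp only [Slice.act] at h
      split at h
      · next a b ρ hd =>
        split_ifs at h with hab
        have hlen : i ≤ σ.length := by
          by_contra hlt
          rw [List.drop_eq_nil_of_le (by omega)] at hd
          cases hd
        have hb : b = !a := by cases a <;> cases b <;> simp_all
        subst hb
        refine ⟨σ.take i, [a, !a], [], ρ, by simpa using hlen, .cap a, ?_, ?_⟩
        · simpa [hd] using (List.take_append_drop i σ).symm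
        · simpa using h.symm
      · cases h
    | cross b =>
      simp only [Slice.act] at h
      split at h
      · next a a' ρ hd =>
        have hlen : i ≤ σ.length := by
          by_contra hlt
          rw [List.drop_eq_nil_of_le (by omega)] at hd
          cases hd
        refine ⟨σ.take i, [a, a'], [a', a], ρ, by simpa using hlen, .cross b a a', ?_, ?_⟩
        · simpa [hd] using (List.take_append_drop i σ).symm
        · simpa using h.symm
      · cases h
  · rintro ⟨A, s, s', B, rfl, hg, rfl, rfl⟩
    cases hg with
    | cup c => exact act_cup A B c
    | cap a => exact act_cap A B a
    | cross b a a' => exact act_cross A B b a a'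

theorem run_exchange (g h : Gen) (i j : ℕ) (hij : i ≤ j) (σ : List Bool) :
    run [⟨i, g⟩, ⟨j + g.out, h⟩] σ = run [⟨j + g.inp, h⟩, ⟨i, g⟩] σ := by
  ext τ
  simp only [run, Option.bind_fun_some, Option.bind_eq_some_iff]
  constructor
  · rintro ⟨ρ, h1, h2⟩
    obtain ⟨A, s, s', B, hA, hg, rfl, rfl⟩ := act_eq_some_iff.1 h1
    obtain ⟨A2, t, t', B2, hA2, hh, e, rfl⟩ := act_eq_some_iff.1 h2
    have hs := hg.length_inp
    have hs' := hg.length_out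
    rw [← List.append_assoc, List.append_eq_append_iff] at e
    rcases e with ⟨M, rfl, rfl⟩ | ⟨M, e1, e2⟩
    · simp only [List.length_append] at hA2
      refine ⟨A ++ (s ++ (M ++ (t' ++ B2))), act_eq_some_iff.2 ⟨A ++ s ++ M, t, t', B2, ?_, hh, ?_, ?_⟩,
        act_eq_some_iff.2 ⟨A, s, s', M ++ (t' ++ B2), hA, hg, rfl, ?_⟩⟩
      · simp only [List.length_append]; omega
      · simp
      · simp
      · simp
    -- Since `i ≤ j`, the second generator cannot begin before the end of the first; this overlap is
    -- empty and the two generators are adjacent.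
    · have hl := congrArg List.length e1
      simp only [List.length_append] at hl
      obtain rfl : M = [] := List.eq_nil_of_length_eq_zero (by omega)
      simp only [List.append_nil, List.nil_append] at e1 e2
      subst e1
      subst e2
      refine ⟨A ++ (s ++ (t' ++ B2)), act_eq_some_iff.2 ⟨A ++ s, t, t', B2, ?_, hh, ?_, ?_⟩,
        act_eq_some_iff.2 ⟨A, s, s', t' ++ B2, hA, hg, rfl, ?_⟩⟩
      · simp only [List.length_append] at hl hA2 ⊢; omega
      · simp
      · simp
      · simp
  · rintro ⟨ρ, h1, h2⟩
    obtain ⟨A2, t, t', B2, hA2, hh, rfl, rfl⟩ := act_eq_some_iff.1 h1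
    obtain ⟨A, s, s', B, hA, hg, e, rfl⟩ := act_eq_some_iff.1 h2
    have hs := hg.length_inp
    have hs' := hg.length_out
    rw [eq_comm, ← List.append_assoc, List.append_eq_append_iff] at e
    rcases e with ⟨M, rfl, rfl⟩ | ⟨M, e1, e2⟩
    · simp only [List.length_append] at hA2
      refine ⟨A ++ (s' ++ (M ++ (t ++ B2))), act_eq_some_iff.2 ⟨A, s, s', M ++ (t ++ B2), hA, hg, ?_, rfl⟩,
        act_eq_some_iff.2 ⟨A ++ s' ++ M, t, t', B2, ?_, hh, ?_, ?_⟩⟩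
      · simp
      · simp only [List.length_append]; omega
      · simp
      · simp
    · have hl := congrArg List.length e1
      simp only [List.length_append] at hl
      obtain rfl : M = [] := List.eq_nil_of_length_eq_zero (by omega)
      simp only [List.append_nil, List.nil_append] at e1 e2
      subst e2
      subst e1
      refine ⟨A ++ (s' ++ (t ++ B2)), act_eq_some_iff.2 ⟨A, s, s', t ++ B2, hA, hg, ?_, rfl⟩,
        act_eq_some_iff.2 ⟨A ++ s', t, t', B2, ?_, hh, ?_, ?_⟩⟩
      · simp
      · simp only [List.length_append] at hl hA2 ⊢; omega
      · simp
      · simp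

/-! ### Isotopy of tangles -/

/-- The words `w` and `w'` have the same effect on the directions `σ` and give isotopic diagrams
in every context in which the strands below have the directions `σ`. -/
def TangleIso (σ : List Bool) (w w' : List Slice) : Prop :=
  run w σ = run w' σ ∧ ∀ (u v : List Slice), run u [] = some σ →
    ∀ (h : Closed (u ++ w ++ v)) (h' : Closed (u ++ w' ++ v)), Isotopic ⟨_, h⟩ ⟨_, h'⟩

namespace TangleIso

theorem of_move {σ : List Bool} {a b : List Slice} (h : LocalMove a b)
    (hr : run a σ = run b σ) : TangleIso σ a b :=
  ⟨hr, fun u v _ _ _ => .rel _ _ ⟨u, v, a, b, h, rfl, rfl⟩⟩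

theorem refl (σ : List Bool) (w : List Slice) : TangleIso σ w w :=
  ⟨rfl, fun _ _ _ _ _ => .refl _⟩

theorem of_eq {σ : List Bool} {w w' : List Slice} (h : w = w') : TangleIso σ w w' :=
  h ▸ refl σ w

theorem symm {σ : List Bool} {w w' : List Slice} (h : TangleIso σ w w') : TangleIso σ w' w :=
  ⟨h.1.symm, fun u v hu hc hc' => (h.2 u v hu hc' hc).symm⟩

theorem trans {σ : List Bool} {w w' w'' : List Slice} (h : TangleIso σ w w')
    (h' : TangleIso σ w' w'') : TangleIso σ w w'' := by
  refine ⟨h.1.trans h'.1, fun u v hu hc hc'' => ?_⟩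
  have hc' : Closed (u ++ w' ++ v) := by
    unfold Closed at hc ⊢
    rw [List.append_assoc, run_append_of_eq hu, run_append] at hc ⊢
    rwa [← h.1]
  exact (h.2 u v hu hc hc').trans _ _ _ (h'.2 u v hu hc' hc'')

theorem append_right {σ : List Bool} {w w' : List Slice} (h : TangleIso σ w w')
    (b : List Slice) : TangleIso σ (w ++ b) (w' ++ b) := by
  refine ⟨by rw [run_append, run_append, h.1], fun u v hu hc hc' => ?_⟩
  have e (x : List Slice) : u ++ (x ++ b) ++ v = u ++ x ++ (b ++ v) := by simp
  simp only [e] at hc hc' ⊢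
  exact h.2 u (b ++ v) hu hc hc'

theorem append_left {σ ρ : List Bool} {w w' a : List Slice} (ha : run a ρ = some σ)
    (h : TangleIso σ w w') : TangleIso ρ (a ++ w) (a ++ w') := by
  refine ⟨by rw [run_append, run_append, ha]; exact h.1, fun u v hu hc hc' => ?_⟩
  have e (x : List Slice) : u ++ (a ++ x) ++ v = u ++ a ++ x ++ v := by simp
  simp only [e] at hc hc' ⊢
  exact h.2 (u ++ a) v (by rw [run_append_of_eq hu, ha]) hc hc'

/-- Congruence on the left, without knowledge of the intermediate directions. -/
theorem append_left_of_forall {ρ : List Bool} {w w' : List Slice} (a : List Slice)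
    (h : ∀ σ, TangleIso σ w w') : TangleIso ρ (a ++ w) (a ++ w') := by
  cases ha : run a ρ with
  | some σ => exact append_left ha (h σ)
  | none =>
    -- If `a` does not act on `ρ`, no closed diagram contains it in this place, so the isotopy claim
    -- is vacuous.
    refine ⟨by rw [run_append, run_append, ha]; rfl, fun u v hu hc _ => ?_⟩
    unfold Closed at hc
    rw [List.append_assoc, run_append_of_eq hu, List.append_assoc, run_append, ha] at hc
    cases hc

theorem cons {σ ρ : List Bool} {w w' : List Slice} {s : Slice} (hs : s.act ρ = some σ)
    (h : TangleIso σ w w') : TangleIso ρ (s :: w) (s :: w') :=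
  append_left (a := [s]) (by simp [run, hs]) h

theorem exchange (σ : List Bool) (g h : Gen) {i j : ℕ} (hij : i ≤ j) :
    TangleIso σ [⟨i, g⟩, ⟨j + g.out, h⟩] [⟨j + g.inp, h⟩, ⟨i, g⟩] :=
  of_move (.exchange g h i j hij) (run_exchange g h i j hij σ)

end TangleIso

/-- A slice with `k` more strands to its left. -/
def Slice.shift (k : ℕ) (s : Slice) : Slice := ⟨s.left + k, s.gen⟩

/-- A generator slides past a whole tangle lying to its right. `v` is numbered from the first strand
to the right of the generator, hence the two shifts. -/
theorem TangleIso.exchange_list (σ : List Bool) (g : Gen) (i : ℕ) (v : List Slice) :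
    TangleIso σ (⟨i, g⟩ :: v.map (Slice.shift (i + g.out)))
      (v.map (Slice.shift (i + g.inp)) ++ [⟨i, g⟩]) := by
  induction v generalizing σ with
  | nil => exact .refl _ _
  | cons s v ih =>
    have h1 := (TangleIso.exchange σ g s.gen (Nat.le_add_left i s.left)).append_right
      (v.map (Slice.shift (i + g.out)))
    have h2 : TangleIso σ ([Slice.shift (i + g.inp) s] ++ (⟨i, g⟩ :: v.map (Slice.shift (i + g.out))))
        ([Slice.shift (i + g.inp) s] ++ (v.map (Slice.shift (i + g.inp)) ++ [⟨i, g⟩])) :=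
      .append_left_of_forall _ ih
    simpa [Slice.shift, Nat.add_assoc] using h1.trans (by simpa [Slice.shift, Nat.add_assoc] using h2)

/-! ### Conway polynomials of words -/

/-- The word `w` is closed and has the Conway polynomial `P`. -/
def WordConway (w : List Slice) (P : ℤ[X]) : Prop := ∃ h : Closed w, HasConway ⟨w, h⟩ P

/-- The form in which isotopies are applied below: equal effect on the directions already makes the
new word closed. -/
theorem TangleIso.conway {σ : List Bool} {w w' u v : List Slice} {P : ℤ[X]}
    (h : TangleIso σ w w') (hu : run u [] = some σ) (hP : WordConway (u ++ (w ++ v)) P) :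
    WordConway (u ++ (w' ++ v)) P := by
  obtain ⟨hc, hP⟩ := hP
  have hc' : Closed (u ++ (w' ++ v)) := by
    unfold Closed at hc ⊢
    rw [run_append_of_eq hu, run_append] at hc ⊢
    rwa [← h.1]
  simp only [← List.append_assoc] at hc hc' hP ⊢
  exact ⟨hc', hP.isotopy (h.2 u v hu hc hc')⟩

theorem closed_congr {u v w w' : List Slice} {σ : List Bool} (hu : run u [] = some σ)
    (h : run w σ = run w' σ) (hc : Closed (u ++ (w ++ v))) : Closed (u ++ (w' ++ v)) := by
  unfold Closed at hc ⊢
  rw [run_append_of_eq hu, run_append] at hc ⊢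
  rwa [← h]

section Skein

variable {u v : List Slice} {A B : List Bool} {a : Bool} {P Q : ℤ[X]}

theorem skeinTriple_parallel (hu : run u [] = some (A ++ a :: a :: B))
    (hp : Closed (u ++ ([⟨A.length, .cross true⟩] ++ v)))
    (hm : Closed (u ++ ([⟨A.length, .cross false⟩] ++ v))) (h0 : Closed (u ++ v)) :
    SkeinTriple ⟨_, hp⟩ ⟨_, hm⟩ ⟨_, h0⟩ :=
  ⟨u, v, A.length, _, a, a, hu, by simp, by simp, by simp, by simp, by simp⟩

/-- For antiparallel strands `cross false` is the positive crossing. The new minimum has direction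
`!a` on its left because the crossing exchanges the two strands. -/
theorem skeinTriple_antiparallel (hu : run u [] = some (A ++ a :: (!a) :: B))
    (hp : Closed (u ++ ([⟨A.length, .cross false⟩] ++ v)))
    (hm : Closed (u ++ ([⟨A.length, .cross true⟩] ++ v)))
    (h0 : Closed (u ++ ([⟨A.length, .cap⟩, ⟨A.length, .cup (!a)⟩] ++ v))) :
    SkeinTriple ⟨_, hp⟩ ⟨_, hm⟩ ⟨_, h0⟩ :=
  ⟨u, v, A.length, _, a, !a, hu, by simp, by simp, by simp, by simp, by simp⟩

theorem run_cross_parallel (b : Bool) :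
    run [⟨A.length, .cross b⟩] (A ++ a :: a :: B) = run [] (A ++ a :: a :: B) := by
  simp [run, act_cross]

theorem run_cross_antiparallel (b : Bool) :
    run [⟨A.length, .cross b⟩] (A ++ a :: (!a) :: B) =
      run [⟨A.length, .cap⟩, ⟨A.length, .cup (!a)⟩] (A ++ a :: (!a) :: B) := by
  simp [run, act_cross, act_cap, act_cup]

theorem conway_parallel_pos (hu : run u [] = some (A ++ a :: a :: B))
    (hm : WordConway (u ++ ([⟨A.length, .cross false⟩] ++ v)) P) (h0 : WordConway (u ++ v) Q) :
    WordConway (u ++ ([⟨A.length, .cross true⟩] ++ v)) (P + X * Q) := by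
  have hc := closed_congr hu ((run_cross_parallel false).trans (run_cross_parallel true).symm) hm.1
  exact ⟨hc, .skein_pos (skeinTriple_parallel hu hc hm.1 h0.1) (by ring) hm.2 h0.2⟩

theorem conway_parallel_neg (hu : run u [] = some (A ++ a :: a :: B))
    (hp : WordConway (u ++ ([⟨A.length, .cross true⟩] ++ v)) P) (h0 : WordConway (u ++ v) Q) :
    WordConway (u ++ ([⟨A.length, .cross false⟩] ++ v)) (P - X * Q) := by
  have hc := closed_congr hu ((run_cross_parallel true).trans (run_cross_parallel false).symm) hp.1
  exact ⟨hc, .skein_neg (skeinTriple_parallel hu hp.1 hc h0.1) (by ring) hp.2 h0.2⟩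

/-- This and its antiparallel analogue are the source of vanishing for split links: the two crossing
changes have the same polynomial, so z times that of the smoothing is zero. -/
theorem conway_parallel_zero (hu : run u [] = some (A ++ a :: a :: B))
    (hp : WordConway (u ++ ([⟨A.length, .cross true⟩] ++ v)) P)
    (hm : WordConway (u ++ ([⟨A.length, .cross false⟩] ++ v)) P) : WordConway (u ++ v) 0 := by
  have hc : Closed (u ++ v) := closed_congr hu (run_cross_parallel (B := B) true) hp.1
  exact ⟨hc, .skein_zero (skeinTriple_parallel hu hp.1 hm.1 hc) (by ring) hp.2 hm.2⟩

theorem conway_antiparallel_pos (hu : run u [] = some (A ++ a :: (!a) :: B))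
    (hm : WordConway (u ++ ([⟨A.length, .cross true⟩] ++ v)) P)
    (h0 : WordConway (u ++ ([⟨A.length, .cap⟩, ⟨A.length, .cup (!a)⟩] ++ v)) Q) :
    WordConway (u ++ ([⟨A.length, .cross false⟩] ++ v)) (P + X * Q) := by
  have hc := closed_congr hu (run_cross_antiparallel (B := B) false).symm h0.1
  exact ⟨hc, .skein_pos (skeinTriple_antiparallel hu hc hm.1 h0.1) (by ring) hm.2 h0.2⟩

theorem conway_antiparallel_neg (hu : run u [] = some (A ++ a :: (!a) :: B))
    (hp : WordConway (u ++ ([⟨A.length, .cross false⟩] ++ v)) P)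
    (h0 : WordConway (u ++ ([⟨A.length, .cap⟩, ⟨A.length, .cup (!a)⟩] ++ v)) Q) :
    WordConway (u ++ ([⟨A.length, .cross true⟩] ++ v)) (P - X * Q) := by
  have hc := closed_congr hu (run_cross_antiparallel (B := B) true).symm h0.1
  exact ⟨hc, .skein_neg (skeinTriple_antiparallel hu hp.1 hc h0.1) (by ring) hp.2 h0.2⟩

theorem conway_antiparallel_zero (hu : run u [] = some (A ++ a :: (!a) :: B))
    (hp : WordConway (u ++ ([⟨A.length, .cross false⟩] ++ v)) P)
    (hm : WordConway (u ++ ([⟨A.length, .cross true⟩] ++ v)) P) :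
    WordConway (u ++ ([⟨A.length, .cap⟩, ⟨A.length, .cup (!a)⟩] ++ v)) 0 := by
  have hc := closed_congr hu (run_cross_antiparallel (B := B) true) hm.1
  exact ⟨hc, .skein_zero (skeinTriple_antiparallel hu hp.1 hm.1 hc) (by ring) hp.2 hm.2⟩

end Skein

/-! ### The polynomials of the torus links -/

/-- The Fibonacci polynomials. -/
noncomputable def fibPoly : ℕ → ℤ[X]
  | 0 => 0
  | 1 => 1
  | n + 2 => fibPoly n + X * fibPoly (n + 1)

/-- The Fibonacci polynomials, extended to negative indices by their recursion. -/
noncomputable def torusPoly : ℤ → ℤ[X]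
  | .ofNat n => fibPoly n
  | .negSucc n => (-1) ^ n * fibPoly (n + 1)

theorem torusPoly_zero : torusPoly 0 = 0 := rfl

theorem torusPoly_one : torusPoly 1 = 1 := rfl

theorem torusPoly_neg_one : torusPoly (-1) = 1 := by
  change (-1) ^ 0 * fibPoly 1 = 1
  simp [fibPoly]

theorem torusPoly_add_one (m : ℤ) : torusPoly (m + 1) = torusPoly (m - 1) + X * torusPoly m := by
  obtain ⟨n, rfl | rfl⟩ := m.eq_nat_or_neg
  · cases n with
    | zero => simp [torusPoly_zero, torusPoly_one, torusPoly_neg_one]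
    | succ n =>
      have h1 : ((n + 1 : ℕ) : ℤ) + 1 = Int.ofNat (n + 2) := by simp; ring
      have h2 : ((n + 1 : ℕ) : ℤ) - 1 = Int.ofNat n := by simp
      rw [h1, h2]
      rfl
  -- At 0 and -1 the recursion meets both constructors of `ℤ`, so these values are checked
  -- separately.
  · match n with
    | 0 => simp [torusPoly_zero, torusPoly_one, torusPoly_neg_one]
    | 1 =>
      have h : torusPoly (-((1 : ℕ) : ℤ) - 1) = (-1) ^ 1 * fibPoly 2 := rfl
      rw [h]
      simp [torusPoly_zero, torusPoly_neg_one, fibPoly]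
    | n + 2 =>
      have h1 : -((n + 2 : ℕ) : ℤ) + 1 = Int.negSucc n := by rw [Int.negSucc_eq]; push_cast; ring
      have h2 : -((n + 2 : ℕ) : ℤ) - 1 = Int.negSucc (n + 2) := by
        rw [Int.negSucc_eq]; push_cast; ring
      have h3 : -((n + 2 : ℕ) : ℤ) = Int.negSucc (n + 1) := by rw [Int.negSucc_eq]; push_cast; ring
      rw [h1, h2, h3]
      simp only [torusPoly, fibPoly]
      ring

/-- Positivity of the Fibonacci numbers then shows that the torus polynomials do not vanish. -/
theorem eval_one_fibPoly (n : ℕ) : (fibPoly n).eval 1 = Nat.fib n := by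
  induction n using Nat.twoStepInduction with
  | zero => simp [fibPoly]
  | one => simp [fibPoly]
  | more n h0 h1 => simp [fibPoly, h0, h1, Nat.fib_add_two]

theorem fibPoly_ne_zero {n : ℕ} (hn : 0 < n) : fibPoly n ≠ 0 := by
  intro h
  have := eval_one_fibPoly n
  rw [h, eval_zero] at this
  have := Nat.fib_pos.2 hn
  omega

theorem torusPoly_ne_zero {m : ℤ} (hm : m ≠ 0) : torusPoly m ≠ 0 := by
  cases m with
  | ofNat n => exact fibPoly_ne_zero (by rcases n with _ | n <;> simp_all)
  | negSucc n => simpa [torusPoly] using fibPoly_ne_zero (Nat.succ_pos n)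

/-! ### Twists -/

theorem twist_natCast (i n : ℕ) : twist i n = List.replicate n ⟨i, .cross true⟩ := by
  cases n with
  | zero => simp [twist]
  | succ n =>
    have : (0 : ℤ) < ((n + 1 : ℕ) : ℤ) := by positivity
    simp only [twist, Int.natAbs_natCast, decide_eq_true this]

theorem twist_neg_natCast (i n : ℕ) : twist i (-n) = List.replicate n ⟨i, .cross false⟩ := by
  simp [twist]

section Local

variable (A B : List Bool) (a : Bool)

theorem run_cross_cross (b b' a a' : Bool) :
    run [⟨A.length, .cross b⟩, ⟨A.length, .cross b'⟩] (A ++ a :: a' :: B) =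
      some (A ++ a :: a' :: B) := by
  simp [run, act_cross]

theorem tangleIso_reidemeisterTwo (b a a' : Bool) :
    TangleIso (A ++ a :: a' :: B) [⟨A.length, .cross b⟩, ⟨A.length, .cross (!b)⟩] [] :=
  .of_move (.reidemeisterTwo _ b) (run_cross_cross A B b (!b) a a')

/-- For `p ≥ 0` the two words coincide; for `p < 0` the new crossing cancels the first one by
Reidemeister II. Thus twists can be handled by induction over `ℤ`. -/
theorem tangleIso_cross_true_twist (a a' : Bool) (p : ℤ) :
    TangleIso (A ++ a :: a' :: B) ([⟨A.length, .cross true⟩] ++ twist A.length p)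
      (twist A.length (p + 1)) := by
  obtain ⟨n, rfl | rfl⟩ := p.eq_nat_or_neg
  · refine .of_eq ?_
    rw [← Nat.cast_succ, twist_natCast, twist_natCast, List.replicate_succ]
    rfl
  · cases n with
    | zero => exact .of_eq (by simp [twist])
    | succ n =>
      have h : -((n + 1 : ℕ) : ℤ) + 1 = -(n : ℤ) := by push_cast; ring
      rw [h, twist_neg_natCast, twist_neg_natCast, List.replicate_succ]
      exact (tangleIso_reidemeisterTwo A B true a a').append_right _

theorem tangleIso_cross_false_twist (a a' : Bool) (p : ℤ) :
    TangleIso (A ++ a :: a' :: B) ([⟨A.length, .cross false⟩] ++ twist A.length p)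
      (twist A.length (p - 1)) := by
  obtain ⟨n, rfl | rfl⟩ := p.eq_nat_or_neg
  · cases n with
    | zero => exact .of_eq (by simp [twist])
    | succ n =>
      have h : ((n + 1 : ℕ) : ℤ) - 1 = (n : ℤ) := by push_cast; ring
      rw [h, twist_natCast, twist_natCast, List.replicate_succ]
      exact (tangleIso_reidemeisterTwo A B false a a').append_right _
  · refine .of_eq ?_
    have h : -(n : ℤ) - 1 = -((n + 1 : ℕ) : ℤ) := by push_cast; ring
    rw [h, twist_neg_natCast, twist_neg_natCast, List.replicate_succ]
    rfl

theorem run_cup_cross (b c : Bool) :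
    run [⟨A.length, .cup c⟩, ⟨A.length, .cross b⟩] (A ++ B) = run [⟨A.length, .cup (!c)⟩] (A ++ B) := by
  simp [run, act_cup, act_cross]

/-- Each Reidemeister I move at a minimum removes one crossing and reverses the minimum, so only the
parity of `m` survives. -/
theorem tangleIso_cup_replicate (b c : Bool) (m : ℕ) :
    TangleIso (A ++ B) ([⟨A.length, .cup c⟩] ++ List.replicate m ⟨A.length, .cross b⟩)
      [⟨A.length, .cup (c ^^ decide (Odd m))⟩] := by
  induction m generalizing c with
  | zero => exact .of_eq (by simp)
  | succ m ih =>
    have h := (TangleIso.of_move (.reidemeisterOneCup A.length b c)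
      (run_cup_cross A B b c)).append_right (List.replicate m ⟨A.length, .cross b⟩)
    have e : (c ^^ decide (Odd (m + 1))) = ((!c) ^^ decide (Odd m)) := by
      by_cases hm : Odd m <;> simp [hm, Nat.odd_add_one]
    rw [e]
    exact h.trans (ih (!c))

theorem tangleIso_cup_twist_odd (c : Bool) {p : ℤ} (hp : Odd p) :
    TangleIso (A ++ B) ([⟨A.length, .cup c⟩] ++ twist A.length p) [⟨A.length, .cup (!c)⟩] := by
  have h := tangleIso_cup_replicate A B (decide (0 < p)) c p.natAbs
  rw [decide_eq_true (Int.natAbs_odd.2 hp), Bool.xor_true] at h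
  exact h

theorem tangleIso_cross_cap (b : Bool) :
    TangleIso (A ++ a :: (!a) :: B) [⟨A.length, .cross b⟩, ⟨A.length, .cap⟩] [⟨A.length, .cap⟩] := by
  refine .of_move (.reidemeisterOneCap _ b) ?_
  have h := act_cap A B (!a)
  rw [Bool.not_not] at h
  simp [run, act_cross, act_cap, h]

end Local

section Twist

variable {u v : List Slice} {A B : List Bool} {a : Bool} {P Q : ℤ[X]}

/-- A box with parallel strands. -/
theorem conway_twist_parallel (hu : run u [] = some (A ++ a :: a :: B))
    (h0 : WordConway (u ++ v) P) (h1 : WordConway (u ++ (twist A.length 1 ++ v)) Q) (p : ℤ) :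
    WordConway (u ++ (twist A.length p ++ v)) (torusPoly p * Q + torusPoly (p - 1) * P) := by
  -- The skein relation is a recursion of order two in `p`, so two consecutive values are carried,
  -- in both directions.
  have key : WordConway (u ++ (twist A.length p ++ v)) (torusPoly p * Q + torusPoly (p - 1) * P) ∧
      WordConway (u ++ (twist A.length (p + 1) ++ v))
        (torusPoly (p + 1) * Q + torusPoly p * P) := by
    induction p with
    | zero => simpa [torusPoly_zero, torusPoly_one, torusPoly_neg_one, twist] using ⟨h0, h1⟩
    | succ p ih =>
      refine ⟨by simpa using ih.2, ?_⟩
      have hm := (tangleIso_cross_false_twist A B a a ((p : ℤ) + 1)).symm.conway hu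
        (by simpa using ih.1)
      rw [List.append_assoc] at hm
      have hp := (tangleIso_cross_true_twist A B a a ((p : ℤ) + 1)).conway hu
        (by simpa using conway_parallel_pos hu hm ih.2)
      convert hp using 1
      rw [torusPoly_add_one ((p : ℤ) + 1), add_sub_cancel_right, torusPoly_add_one p]
      ring
    | pred p ih =>
      refine ⟨?_, by simpa using ih.1⟩
      have hp := (tangleIso_cross_true_twist A B a a (-(p : ℤ))).symm.conway hu ih.2
      rw [List.append_assoc] at hp
      have hm := (tangleIso_cross_false_twist A B a a (-(p : ℤ))).conway hu
        (by simpa using conway_parallel_neg hu hp ih.1)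
      convert hm using 1
      have := torusPoly_add_one (-(p : ℤ) - 1)
      rw [sub_add_cancel] at this
      rw [torusPoly_add_one (-(p : ℤ)), this]
      ring
  exact key.1

/-- An even box with antiparallel strands. -/
theorem conway_twist_antiparallel (hu : run u [] = some (A ++ a :: (!a) :: B))
    (h0 : WordConway (u ++ v) P)
    (h1 : WordConway (u ++ ([⟨A.length, .cap⟩, ⟨A.length, .cup a⟩] ++ v)) Q) (l : ℤ) :
    WordConway (u ++ (twist A.length (2 * l) ++ v)) (P - (l : ℤ[X]) * X * Q) := by
  -- Smoothing one crossing of an even twist leaves an odd number of crossings on a minimum. They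
  -- untwist and reverse it, so every skein step contributes the same `Q`.
  have hs (q : ℤ) (hq : Odd q) : WordConway
      (u ++ ([⟨A.length, .cap⟩, ⟨A.length, .cup (!a)⟩] ++ (twist A.length q ++ v))) Q := by
    have hc : run [⟨A.length, .cap⟩] (A ++ a :: (!a) :: B) = some (A ++ B) := by
      simp [run, act_cap]
    have h := tangleIso_cup_twist_odd A B (!a) hq
    rw [Bool.not_not] at h
    simpa using (h.symm.append_left hc).conway hu h1
  induction l with
  | zero => simpa [twist] using h0
  | succ l ih =>
    have hp := (tangleIso_cross_false_twist A B a (!a) (2 * (l : ℤ) + 1)).symm.conway hu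
      (by simpa using ih)
    rw [List.append_assoc] at hp
    have hm := (tangleIso_cross_true_twist A B a (!a) (2 * (l : ℤ) + 1)).conway hu
      (by simpa using conway_antiparallel_neg hu hp (hs _ ⟨l, rfl⟩))
    convert hm using 1
    · ring_nf
    · push_cast; ring
  | pred l ih =>
    have hm := (tangleIso_cross_true_twist A B a (!a) (2 * (-(l : ℤ)) - 1)).symm.conway hu
      (by simpa using ih)
    rw [List.append_assoc] at hm
    have hp := (tangleIso_cross_false_twist A B a (!a) (2 * (-(l : ℤ)) - 1)).conway hu
      (by simpa using conway_antiparallel_pos hu hm (hs _ ⟨-l - 1, by ring⟩))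
    convert hp using 1
    · ring_nf
    · push_cast; ring

end Twist

/-- The circle is reoriented by adding a kink at the maximum and undoing it at the minimum. -/
theorem conway_circle (b : Bool) : WordConway [⟨0, .cup b⟩, ⟨0, .cap⟩] 1 := by
  have h : WordConway [⟨0, .cup true⟩, ⟨0, .cap⟩] 1 := ⟨unknot.closed, .unknot⟩
  cases b with
  | true => exact h
  | false =>
    have h1 := ((tangleIso_cross_cap [] [] true true).symm.conway (u := [⟨0, .cup true⟩]) (v := [])
      rfl h)
    exact ((TangleIso.of_move (.reidemeisterOneCup 0 true true)
      (run_cup_cross [] [] true true)).conway (u := []) (v := [⟨0, .cap⟩]) rfl h1)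

theorem conway_torusLink (m : ℤ) : HasConway (torusLink m) (torusPoly m) := by
  have hu : run [⟨0, .cup true⟩, ⟨1, .cup true⟩] [] =
    some ([] ++ true :: true :: [false, false]) := rfl
  -- The closure of a single crossing of either sign is an unknot: start from a circle, add a zigzag
  -- and a kink, and slide the kink's crossing over a maximum.
  have h1 (b : Bool) : WordConway ([⟨0, .cup true⟩, ⟨1, .cup true⟩] ++
      ([⟨0, .cross b⟩] ++ [⟨1, .cap⟩, ⟨0, .cap⟩])) 1 := by
    have h := conway_circle true
    have h1 := (TangleIso.of_move (σ := [true, false]) (.zagzig 0 false) rfl).symm.conway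
      (u := [⟨0, .cup true⟩]) (v := [⟨0, .cap⟩]) rfl h
    have h2 := (TangleIso.of_move (σ := [true, false]) (.reidemeisterOneCup 1 (!b) true) rfl).symm.conway
      (u := [⟨0, .cup true⟩]) (v := [⟨0, .cap⟩, ⟨0, .cap⟩]) rfl h1
    have h3 := (TangleIso.of_move (σ := [true, true, false, false]) (.slideCap 0 (!b))
      (by cases b <;> rfl)).conway
      (u := [⟨0, .cup true⟩, ⟨1, .cup true⟩]) (v := [⟨0, .cap⟩]) rfl h2
    simpa using h3
  have h0 : WordConway ([⟨0, .cup true⟩, ⟨1, .cup true⟩] ++ [⟨1, .cap⟩, ⟨0, .cap⟩]) 0 :=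
    conway_parallel_zero hu (h1 true) (h1 false)
  obtain ⟨hc, h⟩ := conway_twist_parallel hu h0 (h1 true) m
  have e : torusLink m = ⟨_, hc⟩ := by simp [torusLink, torusWord]
  rw [e]
  simpa using h

/-! ### Chains of boxes

The pretzel link is isotopic to the closure of a composition of tangles with four strands, one for
each box. -/

section Chain

variable {ι : Type*} (p : ι → ℤ) (y c : ι → Bool)

/-- The tangle of a box together with the bottom arc to its right and the top arc to its left. -/
def boxWord (k : ι) : List Slice := ⟨3, .cup (c k)⟩ :: (twist 2 (p k) ++ [⟨1, .cap⟩])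

def chainWord (ks : List ι) : List Slice := ks.flatMap (boxWord p c)

/-- `y` of the first box is `a`, `c` of each box is `y` of the next one, and `c` of the last
one is `e`. -/
def Linked (a : Bool) : List ι → Bool → Prop
  | [], e => a = e
  | k :: ks, e => y k = a ∧ Linked (c k) ks e

/-- The coefficient with which a box contributes in the skein module of four strands. -/
noncomputable def boxWeight (k : ι) : ℤ[X] :=
  if y k = c k then -((p k / 2 : ℤ) : ℤ[X]) * X else torusPoly (p k)

/-- The coefficient of a maximum below a minimum, whereas `boxWeight` is that of two vertical
strands (antiparallel box) or of one crossing (parallel box). -/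
noncomputable def boxCoweight (k : ι) : ℤ[X] :=
  if y k = c k then 1 else torusPoly (p k - 1)

/-- The number of boxes with parallel strands. -/
def parallelCount (ks : List ι) : ℕ := ks.countP (fun k => decide (y k ≠ c k))

end Chain

/-- The sum over the entries of the list of `g` of this entry times `f` of all other entries. -/
def leibnizSum {ι R : Type*} [CommSemiring R] (f g : ι → R) : List ι → R
  | [] => 0
  | k :: ks => f k * leibnizSum f g ks + g k * (ks.map f).prod

section Chain

variable {ι : Type*} {p : ι → ℤ} {y c : ι → Bool}

/-- The direction is kept by antiparallel boxes and reversed by parallel ones. -/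
theorem Linked.eq {a e : Bool} {ks : List ι} (h : Linked y c a ks e) :
    e = (a ^^ decide (Odd (parallelCount y c ks))) := by
  induction ks generalizing a with
  | nil => simpa [parallelCount] using Eq.symm h
  | cons k ks ih =>
    obtain ⟨rfl, h⟩ := h
    rw [ih h, parallelCount, parallelCount, List.countP_cons]
    by_cases hk : y k = c k
    · simp [hk]
    · have hy : y k = !(c k) := by cases h1 : y k <;> cases h2 : c k <;> simp_all
      rw [hy, if_pos (by simp), Bool.decide_congr Nat.odd_add_one, decide_not]
      cases c k <;> simp

/-- A small circle may be reoriented. -/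
theorem tangleIso_circle (b : Bool) (σ A : List Bool) :
    TangleIso (A ++ σ) [⟨A.length, .cup b⟩, ⟨A.length, .cap⟩]
      [⟨A.length, .cup (!b)⟩, ⟨A.length, .cap⟩] := by
  have h1 := (tangleIso_cross_cap A σ b true).symm.append_left (a := [⟨A.length, .cup b⟩])
    (ρ := A ++ σ) (by simp [run, act_cup])
  exact h1.trans ((TangleIso.of_move (.reidemeisterOneCup A.length true b)
    (run_cup_cross A σ true b)).append_right [⟨A.length, .cap⟩])

/-- The polynomial of a diagram with a split circle is zero. -/
theorem conway_cap_circle_cup {u v : List Slice} {A B : List Bool} {a b e : Bool} {P : ℤ[X]}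
    (hu : run u [] = some (A ++ a :: (!a) :: B))
    (h : WordConway (u ++ ([⟨A.length, .cap⟩, ⟨A.length, .cup e⟩] ++ v)) P) :
    WordConway (u ++ ([⟨A.length, .cap⟩, ⟨A.length, .cup b⟩] ++
      ([⟨A.length, .cap⟩, ⟨A.length, .cup e⟩] ++ v))) 0 := by
  have hcap : run [⟨A.length, .cap⟩] (A ++ a :: (!a) :: B) = some (A ++ B) := by
    simp [run, act_cap]
  have hu' (b : Bool) : run (u ++ [⟨A.length, .cap⟩, ⟨A.length, .cup b⟩]) [] =
      some (A ++ b :: (!b) :: B) := by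
    rw [run_append_of_eq hu]; simp [run, act_cap, act_cup]
  -- A kink of either sign on the minimum `e` does not change the polynomial, and its smoothing
  -- splits off a circle, necessarily with direction `!e`. The other direction follows by
  -- reorienting the circle.
  have main : WordConway (u ++ ([⟨A.length, .cap⟩, ⟨A.length, .cup (!e)⟩] ++
      ([⟨A.length, .cap⟩, ⟨A.length, .cup e⟩] ++ v))) 0 := by
    have hr (x : Bool) : WordConway ((u ++ [⟨A.length, .cap⟩, ⟨A.length, .cup (!e)⟩]) ++
        ([⟨A.length, .cross x⟩] ++ v)) P := by
      have h1 := (TangleIso.of_move (.reidemeisterOneCup A.length x (!e))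
        (run_cup_cross A B x (!e))).symm.append_left hcap
      rw [Bool.not_not] at h1
      simpa using h1.conway hu h
    simpa using conway_antiparallel_zero (hu' (!e)) (hr false) (hr true)
  by_cases hb : b = !e
  · rwa [hb]
  · obtain rfl : b = e := by cases b <;> cases e <;> simp_all
    have h1 := (tangleIso_circle (!b) B A).append_left hcap
    rw [Bool.not_not] at h1
    simpa using h1.conway hu (v := ⟨A.length, .cup b⟩ :: v) (by simpa using main)

/-- The expansion of the chain in the skein module. Two evaluations suffice: `P` for all parallel
boxes replaced by single crossings and the antiparallel ones by vertical strands, and `Q` for the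
whole chain replaced by a maximum below a minimum. Induction resolves the first box. -/
theorem conway_chainWord (ks : List ι) {u v : List Slice} {a e x z : Bool} {P Q : ℤ[X]}
    (hu : run u [] = some [x, a, !a, z]) (hl : Linked y c a ks e)
    (he : ∀ k ∈ ks, y k = c k → Even (p k))
    (hP : WordConway (u ++ (List.replicate (parallelCount y c ks) ⟨1, .cross false⟩ ++ v)) P)
    (hQ : WordConway (u ++ ([⟨1, .cap⟩, ⟨1, .cup e⟩] ++ v)) Q) :
    WordConway (u ++ (chainWord p c ks ++ v))
      ((ks.map (boxWeight p y c)).prod * P +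
        leibnizSum (boxWeight p y c) (boxCoweight p y c) ks * Q) := by
  induction ks generalizing u a P Q x z with
  | nil => simpa [parallelCount, chainWord, leibnizSum] using hP
  | cons k ks ih =>
    obtain ⟨hy, hl'⟩ := hl
    have he' : ∀ k ∈ ks, y k = c k → Even (p k) := fun j hj => he j (List.mem_cons_of_mem _ hj)
    set f := boxWeight p y c with hf
    set g := boxCoweight p y c with hg
    -- the box replaced by two vertical strands
    have hvert : WordConway (u ++ ([⟨3, .cup (c k)⟩, ⟨1, .cap⟩] ++ (chainWord p c ks ++ v)))
        ((ks.map f).prod * Q) := by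
      have hcap : run [⟨1, .cap⟩] [x, a, !a, z] = some ([x] ++ [z]) := by
        cases a <;> simp [run, Slice.act]
      have hu' : run (u ++ [⟨1, .cap⟩, ⟨1, .cup (c k)⟩]) [] = some [x, c k, !(c k), z] := by
        rw [run_append_of_eq hu]; cases a <;> simp [run, Slice.act]
      -- The box has become a maximum below a minimum, and the crossings of the remaining boxes
      -- untwist on this minimum.
      have h1 : WordConway (u ++ [⟨1, .cap⟩, ⟨1, .cup (c k)⟩] ++
          (List.replicate (parallelCount y c ks) ⟨1, .cross false⟩ ++ v)) Q := by
        have h := (tangleIso_cup_replicate [x] [z] false (c k) (parallelCount y c ks)).append_left hcap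
        rw [← hl'.eq] at h
        simpa using h.symm.conway hu (v := v) (by simpa using hQ)
      -- A second maximum and minimum enclose a split circle, so no product of two coweights
      -- survives.
      have h2 : WordConway (u ++ [⟨1, .cap⟩, ⟨1, .cup (c k)⟩] ++
          ([⟨1, .cap⟩, ⟨1, .cup e⟩] ++ v)) 0 := by
        simpa using conway_cap_circle_cup (A := [x]) (B := [z]) (b := c k) (by simpa using hu) hQ
      have h3 := ih hu' hl' he' h1 h2
      have h4 := (TangleIso.exchange [x, a, !a, z] .cap (.cup (c k)) le_rfl).conway hu
        (v := chainWord p c ks ++ v) (by simpa [Gen.out] using h3)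
      simpa [Gen.inp] using h4
    have hchain : chainWord p c (k :: ks) ++ v =
        [⟨3, .cup (c k)⟩] ++ (twist 2 (p k) ++ ([⟨1, .cap⟩] ++ (chainWord p c ks ++ v))) := by
      simp [chainWord, boxWord]
    rw [hchain, ← List.append_assoc u]
    by_cases hk : y k = c k
    · -- antiparallel strands
      obtain ⟨l, hpl⟩ := (he k List.mem_cons_self hk).exists_two_nsmul
      replace hpl : p k = 2 * l := by simpa using hpl
      have hca : c k = a := hk.symm.trans hy
      have hfk : f k = -(l : ℤ[X]) * X := by simp [hf, boxWeight, hk, hpl]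
      have hgk : g k = 1 := by simp [hg, boxCoweight, hk]
      have hcount : parallelCount y c (k :: ks) = parallelCount y c ks := by
        simp [parallelCount, hk]
      rw [hcount] at hP
      rw [hca] at hl' hvert ⊢
      have hu' : run (u ++ [⟨3, .cup a⟩]) [] = some ([x, a] ++ (!a) :: (!(!a)) :: [!a, z]) := by
        rw [run_append_of_eq hu]; cases a <;> rfl
      have h1 := ih hu hl' he' hP hQ
      -- The box replaced by a maximum below a minimum is a pair of zigzags, hence isotopic to
      -- vertical strands.
      have h2 := (TangleIso.of_move (σ := [x, a, !a, z]) (.zagzig 1 (!a))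
        (by cases a <;> rfl)).symm.conway hu h1
      have h3 := (TangleIso.of_move (σ := [x, a, !a, z]) (.zagzig 2 a)
        (by cases a <;> rfl)).symm.conway hu h2
      have h4 := conway_twist_antiparallel (A := [x, a]) hu' (by simpa using hvert) (by simpa using h3) l
      rw [hpl]
      convert h4 using 1
      · rfl
      simp only [List.map_cons, List.prod_cons, leibnizSum, hfk, hgk]
      ring
    · -- parallel strands
      have hca : c k = !a := by rw [← hy]; cases h1 : y k <;> cases h2 : c k <;> simp_all
      have hfk : f k = torusPoly (p k) := by simp [hf, boxWeight, hk]
      have hgk : g k = torusPoly (p k - 1) := by simp [hg, boxCoweight, hk]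
      have hcount : parallelCount y c (k :: ks) = parallelCount y c ks + 1 := by
        simp [parallelCount, hk]
      rw [hcount, List.replicate_succ] at hP
      rw [hca] at hl' hvert ⊢
      have hu' : run (u ++ [⟨3, .cup (!a)⟩]) [] = some ([x, a] ++ (!a) :: (!a) :: [a, z]) := by
        rw [run_append_of_eq hu]; cases a <;> rfl
      have hu'' : run (u ++ [⟨1, .cross false⟩]) [] = some [x, !a, !(!a), z] := by
        rw [run_append_of_eq hu]; cases a <;> rfl
      have h1 : WordConway (u ++ [⟨1, .cross false⟩] ++ ([⟨1, .cap⟩, ⟨1, .cup e⟩] ++ v)) Q := by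
        have h := (tangleIso_cross_cap [x] [z] a false).symm.conway (u := u)
          (v := ⟨1, .cup e⟩ :: v) (by simpa using hu) (by simpa using hQ)
        simpa using h
      have h2 := ih hu'' hl' he' (by simpa using hP) h1
      -- A box with one crossing is that crossing turned by a right angle: read backwards, sliding
      -- over the maximum changes `cross true` to `cross false`, and a zigzag is straightened.
      have h3 := (TangleIso.of_move (σ := [x, !a, a, z]) (.zagzig 2 (!a))
        (by cases a <;> rfl)).symm.conway (u := u ++ [⟨1, .cross false⟩]) (by simpa using hu'') h2
      have h4 := (TangleIso.exchange [x, a, !a, z] (.cross false) (.cup (!a)) (i := 1) (j := 1)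
        le_rfl).conway hu (v := ⟨2, .cap⟩ :: (chainWord p c ks ++ v)) (by simpa [Gen.out] using h3)
      have h5 := (TangleIso.of_move (σ := [x, a, !a, !a, a, z]) (.slideCap 1 true)
        (by cases a <;> rfl)).symm.conway (u := u ++ [⟨3, .cup (!a)⟩])
        (v := chainWord p c ks ++ v) (by simpa using hu') (by simpa [Gen.inp] using h4)
      have h6 := conway_twist_parallel (A := [x, a]) hu' (by simpa using hvert)
        (by simpa [twist] using h5) (p k)
      convert h6 using 1
      · rfl
      simp only [List.map_cons, List.prod_cons, leibnizSum, hfk, hgk]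
      ring

end Chain

/-! ### Isotopy of a pretzel diagram to a closed chain -/

/-- Minima with the orientations `cs`, two strands apart. -/
def cupsWord (i : ℕ) : List Bool → List Slice
  | [] => []
  | c :: cs => ⟨i, .cup c⟩ :: cupsWord (i + 2) cs

/-- Twists with `ps` half twists, two strands apart. -/
def twistsWord (i : ℕ) : List ℤ → List Slice
  | [] => []
  | p :: ps => twist i p ++ twistsWord (i + 2) ps

theorem twist_map_shift (i j : ℕ) (p : ℤ) : (twist i p).map (Slice.shift j) = twist (i + j) p := by
  simp [twist, Slice.shift]

theorem cupsWord_map_shift (i j : ℕ) (cs : List Bool) :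
    (cupsWord i cs).map (Slice.shift j) = cupsWord (i + j) cs := by
  induction cs generalizing i with
  | nil => rfl
  | cons c cs ih => simp [cupsWord, Slice.shift, ih, Nat.add_right_comm]

theorem twistsWord_map_shift (i j : ℕ) (ps : List ℤ) :
    (twistsWord i ps).map (Slice.shift j) = twistsWord (i + j) ps := by
  induction ps generalizing i with
  | nil => rfl
  | cons p ps ih => simp [twistsWord, twist_map_shift, ih, Nat.add_right_comm]

theorem TangleIso.twist_exchange (σ : List Bool) (i : ℕ) (p : ℤ) (v : List Slice) :
    TangleIso σ (twist i p ++ v.map (Slice.shift (i + 2)))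
      (v.map (Slice.shift (i + 2)) ++ twist i p) := by
  unfold twist
  generalize p.natAbs = n
  induction n generalizing σ with
  | zero => exact .of_eq (by simp)
  | succ n ih =>
    have h1 := TangleIso.append_left_of_forall (ρ := σ) [⟨i, .cross (decide (0 < p))⟩] ih
    have h2 := (TangleIso.exchange_list σ (.cross (decide (0 < p))) i v).append_right
      (List.replicate n ⟨i, .cross (decide (0 < p))⟩)
    simpa [List.replicate_succ] using h1.trans (by simpa [Gen.inp, Gen.out] using h2)

theorem TangleIso.cap_exchange_twist (σ : List Bool) (i k : ℕ) (hik : i + 2 ≤ k) (p : ℤ) :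
    TangleIso σ ([⟨k, .cap⟩] ++ twist i p) (twist i p ++ [⟨k, .cap⟩]) := by
  have h := TangleIso.twist_exchange σ i p [⟨k - (i + 2), .cap⟩]
  simp only [List.map_cons, List.map_nil, Slice.shift, Nat.sub_add_cancel hik] at h
  exact h.symm

theorem TangleIso.cap_exchange_twistsWord (σ : List Bool) (i k : ℕ) (ps : List ℤ)
    (hik : i + 2 * ps.length ≤ k) :
    TangleIso σ ([⟨k, .cap⟩] ++ twistsWord i ps) (twistsWord i ps ++ [⟨k, .cap⟩]) := by
  induction ps generalizing i σ with
  | nil => exact .refl _ _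
  | cons p ps ih =>
    rw [List.length_cons] at hik
    have h1 := (TangleIso.cap_exchange_twist σ i k (by omega) p).append_right (twistsWord (i + 2) ps)
    have h2 := TangleIso.append_left_of_forall (ρ := σ) (twist i p)
      (fun τ => ih τ (i + 2) (by omega))
    simpa [twistsWord] using h1.trans (by simpa using h2)

/-- Each maximum passed removes two strands on the left, which lowers the index from `2 * m + 2` to
`2`. -/
theorem TangleIso.cap_exchange_caps (σ : List Bool) (m : ℕ) :
    TangleIso σ ([⟨2 * m + 2, .cap⟩] ++ List.replicate m ⟨1, .cap⟩)
      (List.replicate m ⟨1, .cap⟩ ++ [⟨2, .cap⟩]) := by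
  induction m generalizing σ with
  | zero => exact .refl _ _
  | succ m ih =>
    have h1 := (TangleIso.exchange σ .cap .cap (i := 1) (j := 2 * m + 2) (by omega)).symm.append_right
      (List.replicate m ⟨1, .cap⟩)
    have h2 := TangleIso.append_left_of_forall (ρ := σ) [⟨1, .cap⟩] ih
    simpa [List.replicate_succ, Gen.inp, mul_add] using
      h1.trans (by simpa [Gen.out] using h2)

/-- A zigzag may be added to the rightmost strand above a row of minima. -/
theorem tangleIso_cupsWord_zigzag (ρ : List Bool) (e : Bool) (cs : List Bool) :
    TangleIso (ρ ++ [e]) (cupsWord ρ.length cs)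
      (cupsWord ρ.length (cs ++ [e]) ++ [⟨ρ.length + 2 * cs.length + 1, .cap⟩]) := by
  induction cs generalizing ρ with
  | nil =>
    refine (TangleIso.of_move (.zigzag ρ.length e) ?_).symm
    have h := act_cap (ρ ++ [e]) [] (!e)
    simp only [List.length_append, List.length_singleton, Bool.not_not] at h
    simpa [run, act_cup] using h
  | cons c cs ih =>
    have h := ih (ρ ++ [c, !c])
    simp only [List.length_append, List.length_cons, List.length_nil] at h
    have h' := TangleIso.cons (ρ := ρ ++ [e]) (s := ⟨ρ.length, .cup c⟩) (by simp [act_cup]) h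
    have e1 : ρ.length + 2 * (cs.length + 1) + 1 = ρ.length + (0 + 1 + 1) + 2 * cs.length + 1 := by
      ring
    simpa [cupsWord, e1] using h'

/-- A row of boxes is isotopic to a chain. -/
theorem tangleIso_chainWord {ι : Type*} (p : ι → ℤ) (c : ι → Bool) (ks : List ι)
    (σ : List Bool) :
    TangleIso σ (cupsWord 3 (ks.map c) ++ twistsWord 2 (ks.map p) ++
      List.replicate ks.length ⟨1, .cap⟩) (chainWord p c ks) := by
  induction ks generalizing σ with
  | nil => exact .refl _ _
  | cons k ks ih =>
    -- The first twist moves below the remaining minima; then its maximum moves below all remaining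
    -- minima and twists, which thereby shift two places to the left.
    have h1 (τ : List Bool) := (TangleIso.twist_exchange τ 2 (p k) (cupsWord 1 (ks.map c))).symm
      |>.append_right (twistsWord 4 (ks.map p) ++ [⟨1, .cap⟩] ++ List.replicate ks.length ⟨1, .cap⟩)
    have h2 (τ : List Bool) := (TangleIso.exchange_list τ .cap 1
      (cupsWord 2 (ks.map c) ++ twistsWord 1 (ks.map p))).symm.append_right
        (List.replicate ks.length ⟨1, .cap⟩)
    have h3 := TangleIso.append_left_of_forall (ρ := σ) [⟨3, .cup (c k)⟩] h1
    have h4 := TangleIso.append_left_of_forall (ρ := σ) ([⟨3, .cup (c k)⟩] ++ twist 2 (p k)) h2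
    have h5 := TangleIso.append_left_of_forall (ρ := σ)
      ([⟨3, .cup (c k)⟩] ++ twist 2 (p k) ++ [⟨1, .cap⟩]) ih
    simp only [cupsWord_map_shift, twistsWord_map_shift, List.map_append, Gen.inp, Gen.out] at h3 h4
    have h := (h3.trans (by simpa using h4)).trans (by simpa using h5)
    simpa [cupsWord, twistsWord, chainWord, boxWord, List.replicate_succ] using h

/-- A row of boxes, closed as in a pretzel diagram, is isotopic to a closed chain. -/
theorem exists_tangleIso_closed_chainWord {ι : Type*} (p : ι → ℤ) (c : ι → Bool) (ks : List ι)
    (cs : List Bool) (b : Bool) (hcs : ks.map c = cs ++ [!b])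
    (hw : Closed ([⟨0, .cup b⟩] ++ cupsWord 1 cs ++ twistsWord 0 (ks.map p) ++
      List.replicate cs.length ⟨1, .cap⟩ ++ [⟨0, .cap⟩])) :
    ∃ x, TangleIso [] ([⟨0, .cup b⟩] ++ cupsWord 1 cs ++ twistsWord 0 (ks.map p) ++
      List.replicate cs.length ⟨1, .cap⟩ ++ [⟨0, .cap⟩])
      ([⟨0, .cup x⟩, ⟨2, .cup b⟩] ++ (chainWord p c ks ++ [⟨2, .cap⟩, ⟨0, .cap⟩])) := by
  have hlen : ks.length = cs.length + 1 := by simpa using congrArg List.length hcs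
  -- A zigzag on the rightmost strand supplies the minimum to the right of the last box; its maximum
  -- is then carried up past all twists and inner maxima.
  have h1 := ((tangleIso_cupsWord_zigzag [b] (!b) cs).append_left (a := [⟨0, .cup b⟩]) (ρ := [])
    rfl).append_right (twistsWord 0 (ks.map p) ++ List.replicate cs.length ⟨1, .cap⟩ ++ [⟨0, .cap⟩])
  have h2 (τ : List Bool) := (TangleIso.cap_exchange_twistsWord τ 0 (2 * cs.length + 2) (ks.map p)
    (by simp [hlen]; omega)).append_right (List.replicate cs.length ⟨1, .cap⟩ ++ [⟨0, .cap⟩])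
  have h3 (τ : List Bool) := (TangleIso.cap_exchange_caps τ cs.length).append_right [⟨0, .cap⟩]
  have h4 := TangleIso.append_left_of_forall (ρ := [])
    ([⟨0, .cup b⟩] ++ cupsWord 1 (ks.map c)) h2
  have h5 := TangleIso.append_left_of_forall (ρ := [])
    ([⟨0, .cup b⟩] ++ cupsWord 1 (ks.map c) ++ twistsWord 0 (ks.map p)) h3
  have e1 : [b].length + 2 * cs.length + 1 = 2 * cs.length + 2 := by simp; ring
  rw [e1, ← hcs] at h1
  have h6 := (h1.trans (by simpa using h4)).trans (by simpa using h5)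
  set v : List Slice := [⟨0, .cup b⟩] ++ cupsWord 1 (ks.map c) ++ twistsWord 0 (ks.map p) with hv
  have h7 : TangleIso [] ([⟨0, .cup b⟩] ++ cupsWord 1 cs ++ twistsWord 0 (ks.map p) ++
      List.replicate cs.length ⟨1, .cap⟩ ++ [⟨0, .cap⟩])
      (v ++ (List.replicate cs.length ⟨1, .cap⟩ ++ [⟨2, .cap⟩, ⟨0, .cap⟩])) := by
    simpa [hv] using h6
  have hc : run (v ++ (List.replicate cs.length ⟨1, .cap⟩ ++ [⟨2, .cap⟩, ⟨0, .cap⟩])) [] = some [] :=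
    h7.1.symm.trans hw
  rw [run_append, Option.bind_eq_some_iff] at hc
  obtain ⟨τ, hτ, hr⟩ := hc
  obtain ⟨x, τ, rfl⟩ : ∃ x τ', τ = x :: τ' := by
    cases τ with
    | cons x τ => exact ⟨x, τ, rfl⟩
    | nil => cases h : cs.length <;> simp [h, List.replicate_succ, run, Slice.act] at hr
  refine ⟨x, h7.trans ?_⟩
  -- A zigzag on the leftmost strand above the twists supplies the maximum to the left of the first
  -- box; its minimum slides down to the bottom. Its direction `x` is that of the strand at this
  -- height.
  have h8 := ((TangleIso.of_move (σ := x :: τ) (.zigzag 0 x) (by simp [run, Slice.act])).symm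
    |>.append_left hτ).append_right (List.replicate cs.length ⟨1, .cap⟩ ++ [⟨2, .cap⟩, ⟨0, .cap⟩])
  have h9 := (TangleIso.exchange_list [] (.cup x) 0 v).symm.append_right
    (List.replicate ks.length ⟨1, .cap⟩ ++ [⟨2, .cap⟩, ⟨0, .cap⟩])
  have h10 := (TangleIso.append_left_of_forall (ρ := []) [⟨0, .cup x⟩, ⟨2, .cup b⟩]
    (tangleIso_chainWord p c ks)).append_right [⟨2, .cap⟩, ⟨0, .cap⟩]
  simp only [hv, List.map_append, List.map_cons, List.map_nil, cupsWord_map_shift,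
    twistsWord_map_shift, Slice.shift, Gen.inp, Gen.out] at h9
  rw [hlen, List.replicate_succ] at h9 h10
  refine TangleIso.trans (by simpa using h8) (TangleIso.trans ?_ (by simpa using h10))
  simpa [hv] using h9

/-! ### Orientations of a chain -/

theorem run_twist (A B : List Bool) (a a' : Bool) (p : ℤ) :
    run (twist A.length p) (A ++ a :: a' :: B) =
      some (if Even p then A ++ a :: a' :: B else A ++ a' :: a :: B) := by
  simp only [← Int.natAbs_even, twist]
  generalize p.natAbs = n
  induction n generalizing a a' with
  | zero => simp [run]
  | succ n ih =>
    simp only [List.replicate_succ, run, act_cross, Option.bind_some, ih]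
    by_cases h : Even n <;> simp [h, Nat.even_add_one]

theorem run_boxWord {ι : Type*} (p : ι → ℤ) (c : ι → Bool) (k : ι) (x a a' z : Bool) :
    run (boxWord p c k) [x, a, a', z] =
      if Even (p k) then (if a = a' then none else some [x, c k, !(c k), z])
      else (if a = c k then none else some [x, a', !(c k), z]) := by
  have h := run_twist [x, a] [!(c k), z] a' (c k) (p k)
  simp only [List.length_cons, List.length_nil, Nat.reduceAdd, List.cons_append,
    List.nil_append] at h
  simp only [boxWord, run, Slice.act, List.length_cons, List.length_nil, List.take, List.drop]
  simp only [run_append, List.cons_append, List.nil_append, Option.bind_some, Nat.reduceAdd, Nat.reduceLeDiff, if_true, h]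
  by_cases hp : Even (p k) <;> simp [hp, run, Slice.act]

/-- If the middle strands are parallel, an even box would make two equal directions meet at its
maximum, and an odd box leaves them parallel. -/
theorem odd_of_run_chainWord {ι : Type*} {p : ι → ℤ} {c : ι → Bool} {ks : List ι} {v : List Slice}
    {x a z : Bool} {τ : List Bool} (h : run (chainWord p c ks ++ v) [x, a, a, z] = some τ) :
    ∀ k ∈ ks, ¬ Even (p k) := by
  induction ks generalizing a with
  | nil => simp
  | cons k ks ih =>
    rw [chainWord, List.flatMap_cons, List.append_assoc, run_append, run_boxWord] at h
    by_cases hp : Even (p k)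
    · simp [hp] at h
    · by_cases hc : a = c k
      · simp [hp, hc] at h
      · have hc' : (!(c k)) = a := by cases h1 : c k <;> cases a <;> simp_all
        simp only [hp, hc, hc', if_false, Option.bind_some] at h
        simp only [List.mem_cons, forall_eq_or_imp]
        exact ⟨hp, ih h⟩

/-- Antiparallel middle strands stay antiparallel after every box, and the maximum of an odd box
then forces the strands of the box to be parallel. -/
theorem even_of_run_chainWord {ι : Type*} {p : ι → ℤ} {y c : ι → Bool} {ks : List ι}
    {v : List Slice} {x a z e : Bool} {τ : List Bool}
    (h : run (chainWord p c ks ++ v) [x, a, !a, z] = some τ) (hl : Linked y c a ks e) :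
    ∀ k ∈ ks, y k = c k → Even (p k) := by
  induction ks generalizing a with
  | nil => simp
  | cons k ks ih =>
    obtain ⟨rfl, hl⟩ := hl
    rw [chainWord, List.flatMap_cons, List.append_assoc, run_append, run_boxWord] at h
    by_cases hp : Even (p k)
    · simp only [hp, if_true, Bool.eq_not_self, if_false, Option.bind_some] at h
      simpa [hp] using ih h hl
    · by_cases hc : y k = c k
      · simp [hp, hc] at h
      · have hc' : (!(y k)) = c k := by cases h1 : c k <;> cases h2 : y k <;> simp_all
        simp only [hp, hc, hc', if_false, Option.bind_some] at h
        simpa [hp, hc] using ih h hl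

/-! ### The polynomial of a closed chain -/

theorem conway_closed_replicate (a : Bool) (j : ℕ) :
    WordConway ([⟨0, .cup (!a)⟩, ⟨2, .cup (!a)⟩] ++
      (List.replicate (2 * j) ⟨1, .cross false⟩ ++ [⟨2, .cap⟩, ⟨0, .cap⟩])) ((j : ℤ[X]) * X) ∧
    WordConway ([⟨0, .cup (!a)⟩, ⟨2, .cup (!a)⟩] ++
      ([⟨1, .cap⟩, ⟨1, .cup a⟩] ++ [⟨2, .cap⟩, ⟨0, .cap⟩])) 1 := by
  have hu : run [⟨0, .cup (!a)⟩, ⟨2, .cup (!a)⟩] [] = some ([!a] ++ a :: (!a) :: [a]) := by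
    cases a <;> rfl
  have h1 : WordConway ([⟨0, .cup (!a)⟩, ⟨2, .cup (!a)⟩] ++
      ([⟨1, .cap⟩, ⟨1, .cup a⟩] ++ [⟨2, .cap⟩, ⟨0, .cap⟩])) 1 := by
    have h := conway_circle (!a)
    have h1 := (TangleIso.of_move (σ := [!a, a]) (.zagzig 1 (!a)) (by cases a <;> rfl)).symm.conway
      (u := [⟨0, .cup (!a)⟩]) (v := [⟨0, .cap⟩]) (by cases a <;> rfl) h
    exact (TangleIso.of_move (σ := [!a, a]) (.zigzag 1 a) (by cases a <;> rfl)).symm.conway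
      (u := [⟨0, .cup (!a)⟩, ⟨2, .cup (!a)⟩, ⟨1, .cap⟩]) (v := [⟨0, .cap⟩]) (by cases a <;> rfl) h1
  have h0 : WordConway ([⟨0, .cup (!a)⟩, ⟨2, .cup (!a)⟩] ++ [⟨2, .cap⟩, ⟨0, .cap⟩]) 0 := by
    have hr (b : Bool) : WordConway ([⟨0, .cup (!a)⟩] ++ ([⟨0, .cross b⟩] ++ [⟨0, .cap⟩])) 1 :=
      (tangleIso_cross_cap [] [] (!a) b).symm.conway (u := [⟨0, .cup (!a)⟩]) (v := []) rfl
        (conway_circle (!a))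
    have h := conway_antiparallel_zero (A := []) (B := []) (a := !a) rfl (hr false) (hr true)
    rw [Bool.not_not] at h
    have h2 := (tangleIso_circle a [] []).conway (u := [⟨0, .cup (!a)⟩, ⟨0, .cap⟩]) (v := [])
      (by cases a <;> rfl) h
    have h3 := (TangleIso.exchange [!a, a] .cap (.cup (!a)) (i := 0) (j := 0) le_rfl).conway
      (u := [⟨0, .cup (!a)⟩]) (v := [⟨0, .cap⟩]) (by cases a <;> rfl) h2
    exact (TangleIso.exchange [!a, a, !a, a] .cap .cap (i := 0) (j := 0) le_rfl).conway
      (u := [⟨0, .cup (!a)⟩, ⟨2, .cup (!a)⟩]) (v := []) (by cases a <;> rfl) h3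
  refine ⟨?_, h1⟩
  -- The crossings are `cross false`, so there are `-j` full twists, and the two signs cancel.
  have h := conway_twist_antiparallel hu h0 h1 (-j)
  have e : (2 * -(j : ℤ)) = -((2 * j : ℕ) : ℤ) := by push_cast; ring
  rw [e, twist_neg_natCast] at h
  simpa using h

/-! ### Pretzel links -/

theorem cupsWord_finRange (i m : ℕ) (f : Fin m → Bool) :
    cupsWord i ((List.finRange m).map f) =
      (List.finRange m).map (fun k => ⟨i + 2 * k, .cup (f k)⟩) := by
  induction m generalizing i with
  | zero => rfl
  | succ m ih =>
    simp only [List.finRange_succ, List.map_cons, List.map_map, cupsWord]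
    rw [ih (i + 2) (f ∘ Fin.succ)]
    simp only [Fin.val_zero, mul_zero, add_zero, List.cons.injEq, true_and]
    refine List.map_congr_left fun k _ => ?_
    simp only [Function.comp_apply, Fin.val_succ, Slice.mk.injEq, and_true]
    ring

theorem twistsWord_finRange (i m : ℕ) (p : Fin m → ℤ) :
    twistsWord i ((List.finRange m).map p) =
      (List.finRange m).flatMap (fun k : Fin m => twist (i + 2 * (k : ℕ)) (p k)) := by
  induction m generalizing i with
  | zero => rfl
  | succ m ih =>
    simp only [List.finRange_succ, List.map_cons, List.map_map, twistsWord, List.flatMap_cons,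
      List.flatMap_map]
    rw [ih (i + 2) (p ∘ Fin.succ)]
    simp only [Fin.val_zero, mul_zero, add_zero, List.append_cancel_left_eq]
    refine List.flatMap_congr fun k _ => ?_
    simp only [Function.comp_apply, Fin.val_succ]
    congr 1
    ring

theorem pretzelWord_eq {m : ℕ} (p : Fin (m + 1) → ℤ) (d : Fin (m + 1) → Bool) :
    pretzelWord p d = [⟨0, .cup (!(d 0))⟩] ++
      cupsWord 1 ((List.finRange m).map (fun k => d k.succ)) ++
      twistsWord 0 ((List.finRange (m + 1)).map p) ++
      List.replicate ((List.finRange m).map (fun k => d k.succ)).length ⟨1, .cap⟩ ++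
      [⟨0, .cap⟩] := by
  rw [cupsWord_finRange, twistsWord_finRange]
  have h : (List.finRange (m + 1)).tail.map
      (fun k : Fin (m + 1) => (⟨2 * (k : ℕ) - 1, .cup (d k)⟩ : Slice)) =
      (List.finRange m).map (fun k => ⟨1 + 2 * k, .cup (d k.succ)⟩) := by
    rw [List.finRange_succ, List.tail_cons, List.map_map]
    refine List.map_congr_left fun k _ => ?_
    simp only [Function.comp_apply, Fin.val_succ, Slice.mk.injEq, and_true]
    omega
  simp [pretzelWord, h]

theorem linked_finRange (m : ℕ) (g : Fin (m + 1) → Bool) :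
    Linked (fun k : Fin m => g k.castSucc) (fun k => g k.succ) (g 0) (List.finRange m)
      (g (Fin.last m)) := by
  -- An arbitrary indexing map `f` keeps the type of the list entries fixed when the induction
  -- composes with `Fin.succ`.
  have key : ∀ (m : ℕ) {ι : Type} (y c : ι → Bool) (f : Fin m → ι) (g : Fin (m + 1) → Bool),
      (∀ k, y (f k) = g k.castSucc) → (∀ k, c (f k) = g k.succ) →
      Linked y c (g 0) ((List.finRange m).map f) (g (Fin.last m)) := by
    intro m
    induction m with
    | zero => intro ι y c f g _ _; rfl
    | succ m ih =>
      intro ι y c f g hy hc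
      rw [List.finRange_succ, List.map_cons, List.map_map]
      refine ⟨hy 0, ?_⟩
      rw [hc 0]
      exact ih y c (f ∘ Fin.succ) (g ∘ Fin.succ) (fun k => hy k.succ) (fun k => hc k.succ)
  simpa using key m _ _ id g (fun _ => rfl) (fun _ => rfl)

theorem linked_cyclic {m : ℕ} (d : Fin (m + 1) → Bool) :
    Linked d (fun k => d (k + 1)) (d 0) (List.finRange (m + 1)) (d 0) := by
  have h := linked_finRange (m + 1) (fun k : Fin (m + 2) => d (Fin.ofNat (m + 1) k))
  have e1 : (fun k : Fin (m + 1) => d (Fin.ofNat (m + 1) k.castSucc)) = d := by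
    funext k; simp
  have e2 : (fun k : Fin (m + 1) => d (Fin.ofNat (m + 1) k.succ)) = fun k => d (k + 1) := by
    funext k
    congr 1
    ext
    simp [Fin.val_add]
  rw [e1, e2] at h
  simpa using h

theorem map_cyclic_finRange {m : ℕ} (d : Fin (m + 1) → Bool) :
    (List.finRange (m + 1)).map (fun k => d (k + 1)) =
      (List.finRange m).map (fun k => d k.succ) ++ [d 0] := by
  rw [List.finRange_succ_last, List.map_append, List.map_map]
  simp [Function.comp_def, Fin.coeSucc_eq_succ]

/-- The Conway polynomial of a pretzel link with an even box, together with the fact that the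
strands of all odd boxes are parallel. -/
theorem conway_pretzelLink {m : ℕ} (p : Fin (m + 1) → ℤ) (d : Fin (m + 1) → Bool)
    (hd : Closed (pretzelWord p d)) (hp : ∃ k, Even (p k)) :
    (∀ k, d k = d (k + 1) → Even (p k)) ∧
    ∃ j : ℕ, parallelCount d (fun k => d (k + 1)) (List.finRange (m + 1)) = 2 * j ∧
    HasConway (pretzelLink p d hd)
      (((List.finRange (m + 1)).map (boxWeight p d (fun k => d (k + 1)))).prod * ((j : ℤ[X]) * X) +
        leibnizSum (boxWeight p d (fun k => d (k + 1))) (boxCoweight p d (fun k => d (k + 1)))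
          (List.finRange (m + 1))) := by
  have hw := hd
  rw [pretzelWord_eq] at hw
  obtain ⟨x, hx⟩ := exists_tangleIso_closed_chainWord p (fun k => d (k + 1))
    (List.finRange (m + 1)) _ (!(d 0)) (by rw [map_cyclic_finRange, Bool.not_not]) hw
  have hc : Closed ([⟨0, .cup x⟩, ⟨2, .cup (!(d 0))⟩] ++
      (chainWord p (fun k => d (k + 1)) (List.finRange (m + 1)) ++ [⟨2, .cap⟩, ⟨0, .cap⟩])) :=
    hx.1.symm.trans hw
  have hu : run [⟨0, .cup x⟩, ⟨2, .cup (!(d 0))⟩] [] = some [x, !x, !(d 0), d 0] := by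
    cases x <;> cases d 0 <;> rfl
  have hr := hc
  unfold Closed at hr
  rw [run_append_of_eq hu] at hr
  obtain ⟨k, hk⟩ := hp
  -- Otherwise the middle strands start parallel and all boxes are odd.
  have hxd : x = !(d 0) := by
    by_contra hne
    have : (!x) = !(d 0) := by cases h1 : x <;> cases h2 : d 0 <;> simp_all
    rw [this] at hr
    exact odd_of_run_chainWord hr k (List.mem_finRange k) hk
  subst hxd
  rw [Bool.not_not] at hu hr
  have he := even_of_run_chainWord hr (linked_cyclic d)
  refine ⟨fun k => he k (List.mem_finRange k), ?_⟩
  -- Going once around returns to the direction `d 0`, so the number of reversals is even.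
  have hpar := (linked_cyclic d).eq
  obtain ⟨j, hj⟩ : 2 ∣ parallelCount d (fun k => d (k + 1)) (List.finRange (m + 1)) := by
    rw [← even_iff_two_dvd, ← Nat.not_odd_iff_even]
    intro ho
    simp [ho] at hpar
  refine ⟨j, hj, ?_⟩
  obtain ⟨hP, hQ⟩ := conway_closed_replicate (d 0) j
  rw [← hj] at hP
  have h := hx.symm.conway (u := []) (v := []) rfl
    (by simpa using conway_chainWord _ hu (linked_cyclic d) he hP hQ)
  rw [List.append_nil, List.nil_append, ← pretzelWord_eq] at h
  exact h.2

/-! ### Evaluation of the sums -/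

theorem leibnizSum_eq_sum {ι R : Type*} [CommSemiring R] [DecidableEq ι] (f g : ι → R)
    {ks : List ι} (h : ks.Nodup) :
    leibnizSum f g ks = ∑ i ∈ ks.toFinset, g i * ∏ j ∈ ks.toFinset.erase i, f j := by
  induction ks with
  | nil => simp [leibnizSum]
  | cons k ks ih =>
    obtain ⟨hk, h⟩ := List.nodup_cons.1 h
    have hk' : k ∉ ks.toFinset := by simpa using hk
    rw [leibnizSum, ih h, List.toFinset_cons, Finset.sum_insert hk', Finset.erase_insert hk',
      List.prod_toFinset f h, add_comm, Finset.mul_sum]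
    congr 1
    refine Finset.sum_congr rfl fun i hi => ?_
    have hik : k ≠ i := fun e => hk' (e ▸ hi)
    rw [Finset.erase_insert_of_ne hik,
      Finset.prod_insert (fun hm => hk' (Finset.mem_of_mem_erase hm))]
    ring

/-- For `p > 0` the index `p - 1` is `shrink p`; for `p < 0` the recursion leads from `p - 1` to
`shrink p = p + 1`. The factor 2 keeps the common formula integral. -/
theorem torusPoly_sub_one {p : ℤ} (hp : p ≠ 0) :
    2 * torusPoly (p - 1) = 2 * torusPoly (shrink p) + ((p.sign - 1 : ℤ) : ℤ[X]) * X * torusPoly p := by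
  rcases lt_or_gt_of_ne hp with h | h
  · have e : shrink p = p + 1 := by rw [shrink, Int.sign_eq_neg_one_of_neg h, abs_of_neg h]; ring
    rw [e, Int.sign_eq_neg_one_of_neg h, torusPoly_add_one]
    push_cast
    ring
  · have e : shrink p = p - 1 := by rw [shrink, Int.sign_eq_one_of_pos h, abs_of_pos h]; ring
    rw [e, Int.sign_eq_one_of_pos h]
    simp

theorem parallelCount_finRange {n : ℕ} (y c : Fin n → Bool) :
    parallelCount y c (List.finRange n) = (Finset.univ.filter (fun k => y k ≠ c k)).card := by
  rw [parallelCount, List.countP_eq_length_filter, Fin.univ_def]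
  rfl

/-- Division is used over `R` only: on `E`, the antiparallel boxes, `f` may vanish. -/
theorem sum_mul_prod_erase_union {ι K : Type*} [Field K] [DecidableEq ι] {E R : Finset ι}
    (hER : Disjoint E R) (f g : ι → K) (hf : ∀ i ∈ R, f i ≠ 0) :
    ∑ i ∈ E ∪ R, g i * ∏ j ∈ (E ∪ R).erase i, f j =
      (∑ i ∈ E, g i * ∏ j ∈ E.erase i, f j) * ∏ i ∈ R, f i +
        (∏ i ∈ E, f i) * (∏ i ∈ R, f i) * ∑ i ∈ R, g i / f i := by
  rw [Finset.sum_union hER, Finset.sum_mul, Finset.mul_sum]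
  congr 1
  · refine Finset.sum_congr rfl fun i hi => ?_
    have hiR : i ∉ R := Finset.disjoint_left.1 hER hi
    rw [Finset.erase_union_distrib, Finset.erase_eq_of_notMem hiR,
      Finset.prod_union (hER.mono_left (Finset.erase_subset _ _)), mul_assoc]
  · refine Finset.sum_congr rfl fun i hi => ?_
    rw [← Finset.prod_union hER, ← Finset.mul_prod_erase _ _ (Finset.mem_union_right E hi)]
    field_simp [hf i hi]

theorem pretzel_sum_eq {ι K : Type*} [Field K] [CharZero K] [DecidableEq ι]
    {E S O : Finset ι} (hSO : Disjoint S O) (hE : Disjoint E (S ∪ O)) {j : ℕ}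
    (hj : (S ∪ O).card = 2 * j) (f g τ τ' s l : ι → K) (z : K)
    (hfE : ∀ i ∈ E, f i = -l i * z) (hgE : ∀ i ∈ E, g i = 1)
    (hf : ∀ i ∈ S ∪ O, f i = τ i) (hτ : ∀ i ∈ S ∪ O, τ i ≠ 0)
    (hg : ∀ i ∈ S ∪ O, 2 * g i = 2 * τ' i + (s i - 1) * z * τ i) :
    (∏ i ∈ E ∪ (S ∪ O), f i) * (j * z) +
        ∑ i ∈ E ∪ (S ∪ O), g i * ∏ k ∈ (E ∪ (S ∪ O)).erase i, f k =
      (∏ k ∈ E, -l k) * z ^ E.card * (∏ k ∈ O, τ k) * (∏ k ∈ S, τ k) *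
          ((∑ k ∈ O, s k + ∑ k ∈ S, s k) / 2 * z + ∑ k ∈ S, τ' k / τ k + ∑ k ∈ O, τ' k / τ k) +
        (∑ i ∈ E, ∏ j ∈ E.erase i, -l j) * z ^ (E.card - 1) * (∏ k ∈ O, τ k) *
          (∏ k ∈ S, τ k) := by
  rw [sum_mul_prod_erase_union hE f g (fun i hi => by rw [hf i hi]; exact hτ i hi),
    Finset.prod_union hE, Finset.prod_congr rfl hf, Finset.prod_union hSO]
  have h1 : ∏ i ∈ E, f i = (∏ k ∈ E, -l k) * z ^ E.card := by
    rw [Finset.prod_congr rfl hfE, Finset.prod_mul_distrib, Finset.prod_const]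
  -- For empty `E` the truncated exponent is harmless, as the sum is zero.
  have h2 : ∑ i ∈ E, g i * ∏ j ∈ E.erase i, f j =
      (∑ i ∈ E, ∏ j ∈ E.erase i, -l j) * z ^ (E.card - 1) := by
    rw [Finset.sum_mul]
    refine Finset.sum_congr rfl fun i hi => ?_
    rw [hgE i hi, one_mul, Finset.prod_congr rfl fun k hk => hfE k (Finset.mem_of_mem_erase hk),
      Finset.prod_mul_distrib, Finset.prod_const, Finset.card_erase_of_mem hi]
  -- Each of the `2 * j` parallel boxes contributes -z/2, and the resulting `-j * z` cancels the
  -- closure term.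
  have h3 : ∑ i ∈ S ∪ O, g i / f i = ∑ k ∈ S, τ' k / τ k + ∑ k ∈ O, τ' k / τ k +
      ((∑ k ∈ O, s k + ∑ k ∈ S, s k) / 2 - j) * z := by
    have h (i) (hi : i ∈ S ∪ O) : g i / f i = τ' i / τ i + (s i / 2 - 1 / 2) * z := by
      rw [hf i hi]
      have := hτ i hi
      field_simp
      linear_combination hg i hi
    have hc : ((S ∪ O).card : K) = 2 * j := by rw [hj]; push_cast; ring
    rw [Finset.sum_congr rfl h, Finset.sum_add_distrib, ← Finset.sum_mul, Finset.sum_sub_distrib,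
      Finset.sum_const, nsmul_eq_mul, hc, ← Finset.sum_div, Finset.sum_union hSO,
      Finset.sum_union hSO]
    ring
  rw [h1, h2, h3]
  ring

end LinkDiagram

/-! ### The formula in the fraction field -/

theorem mainTheorem4 :
    ∃ T : ℤ → ℤ[X],
      -- `T m` is the Conway polynomial of the torus link `T(2, m)`, and it is nonzero for `m ≠ 0`
      (∀ m : ℤ, LinkDiagram.HasConway (LinkDiagram.torusLink m) (T m)) ∧
      (∀ m : ℤ, m ≠ 0 → T m ≠ 0) ∧
      ∀ (n : ℕ) [NeZero n] (p : Fin n → ℤ) (d : Fin n → Bool)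
        (hd : LinkDiagram.Closed (LinkDiagram.pretzelWord p d)) (l : Fin n → ℤ)
        (E S O : Finset (Fin n)) (t : ℕ) (α β : ℤ)
        (N : ℤ → FractionRing ℤ[X]) (z : FractionRing ℤ[X]),
        -- there is at least one even box
        (∃ k, Even (p k)) →
        -- even boxes whose strands run in the same direction are not empty
        (∀ k ∈ LinkDiagram.evenSame p d, p k ≠ 0) →
        (∀ k, Even (p k) → p k = 2 * l k) →
        E = LinkDiagram.evenOpp p d → S = LinkDiagram.evenSame p d → O = LinkDiagram.oddBoxes p →
        t = E.card → α = ∑ k ∈ O, (p k).sign → β = ∑ k ∈ S, (p k).sign →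
        (∀ m, N m = algebraMap ℤ[X] (FractionRing ℤ[X]) (T m)) →
        z = algebraMap ℤ[X] (FractionRing ℤ[X]) X →
        ∃ P : ℤ[X], LinkDiagram.HasConway (LinkDiagram.pretzelLink p d hd) P ∧
          algebraMap ℤ[X] (FractionRing ℤ[X]) P =
            (∏ k ∈ E, (-(l k : FractionRing ℤ[X]))) * z ^ t *
                (∏ k ∈ O, N (p k)) * (∏ k ∈ S, N (p k)) *
                (((α + β : ℤ) : FractionRing ℤ[X]) / 2 * z
                  + ∑ k ∈ S, N (LinkDiagram.shrink (p k)) / N (p k)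
                  + ∑ k ∈ O, N (LinkDiagram.shrink (p k)) / N (p k))
              + (∑ i ∈ E, ∏ j ∈ E.erase i, (-(l j : FractionRing ℤ[X]))) * z ^ (t - 1) *
                (∏ k ∈ O, N (p k)) * (∏ k ∈ S, N (p k)) := by
  refine ⟨LinkDiagram.torusPoly, LinkDiagram.conway_torusLink,
    fun m hm => LinkDiagram.torusPoly_ne_zero hm, ?_⟩
  intro n _ p d hd l E S O t α β N z hp hS hl hE hS' hO ht hα hβ hN hz
  obtain _ | m := n
  · exact absurd rfl (NeZero.ne 0)
  obtain ⟨heven, j, hj, hP⟩ := LinkDiagram.conway_pretzelLink p d hd hp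
  refine ⟨_, hP, ?_⟩
  have hopp (k) : LinkDiagram.IsOpposite d k ↔ d k = d (k + 1) := by
    unfold LinkDiagram.IsOpposite
    cases d k <;> cases d (k + 1) <;> simp
  have memE (k) : k ∈ E ↔ d k = d (k + 1) := by
    simp only [hE, LinkDiagram.evenOpp, Finset.mem_filter, Finset.mem_univ, true_and, hopp]
    exact ⟨And.right, fun h => ⟨heven k h, h⟩⟩
  have memS (k) : k ∈ S ↔ Even (p k) ∧ d k ≠ d (k + 1) := by
    simp [hS', LinkDiagram.evenSame, hopp]
  have memO (k) : k ∈ O ↔ Odd (p k) := by simp [hO, LinkDiagram.oddBoxes]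
  -- Odd boxes are parallel by `heven`, so `S ∪ O` consists of all parallel boxes.
  have memSO (k) : k ∈ S ∪ O ↔ d k ≠ d (k + 1) := by
    rw [Finset.mem_union, memS, memO, ← Int.not_even_iff_odd]
    have := heven k
    tauto
  have hSO : Disjoint S O := by
    rw [Finset.disjoint_left]
    intro k h1 h2
    rw [memS] at h1
    rw [memO, ← Int.not_even_iff_odd] at h2
    exact h2 h1.1
  have hESO : Disjoint E (S ∪ O) := by
    rw [Finset.disjoint_left]
    intro k h1 h2
    exact (memSO k).1 h2 ((memE k).1 h1)
  have huniv : E ∪ (S ∪ O) = Finset.univ := by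
    ext k
    rw [Finset.mem_union, memE, memSO]
    simp [em]
  have hcard : (S ∪ O).card = 2 * j := by
    rw [← hj, LinkDiagram.parallelCount_finRange]
    congr 1
    ext k
    simp [memSO]
  have hp0 (k) (hk : k ∈ S ∪ O) : p k ≠ 0 := by
    rcases Finset.mem_union.1 hk with h | h
    · exact hS k (hS' ▸ h)
    · rintro h0
      rw [memO, h0] at h
      simp at h
  have key := LinkDiagram.pretzel_sum_eq hSO hESO hcard
    (fun k => algebraMap ℤ[X] (FractionRing ℤ[X])
      (LinkDiagram.boxWeight p d (fun k => d (k + 1)) k))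
    (fun k => algebraMap ℤ[X] (FractionRing ℤ[X])
      (LinkDiagram.boxCoweight p d (fun k => d (k + 1)) k))
    (fun k => N (p k)) (fun k => N (LinkDiagram.shrink (p k)))
    (fun k => ((p k).sign : FractionRing ℤ[X])) (fun k => (l k : FractionRing ℤ[X])) z
    (fun k hk => by
      have h := (memE k).1 hk
      have h2 : p k / 2 = l k := by rw [hl k (heven k h)]; simp
      simp [LinkDiagram.boxWeight, h, h2, hz])
    (fun k hk => by simp [LinkDiagram.boxCoweight, (memE k).1 hk])
    (fun k hk => by simp [LinkDiagram.boxWeight, (memSO k).1 hk, hN])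
    (fun k hk => by
      rw [hN]
      exact (map_ne_zero_iff _ (IsFractionRing.injective ℤ[X] (FractionRing ℤ[X]))).2
        (LinkDiagram.torusPoly_ne_zero (hp0 k hk)))
    (fun k hk => by
      have h := congrArg (algebraMap ℤ[X] (FractionRing ℤ[X]))
        (LinkDiagram.torusPoly_sub_one (hp0 k hk))
      have h2 : algebraMap ℤ[X] (FractionRing ℤ[X]) 2 = 2 := map_ofNat _ 2
      simpa [LinkDiagram.boxCoweight, h2, (memSO k).1 hk, hN, hz] using h)
  rw [huniv] at key
  rw [ht, hα, hβ]
  push_cast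
  rw [← key, LinkDiagram.leibnizSum_eq_sum _ _ (List.nodup_finRange _), List.toFinset_finRange,
    ← List.prod_toFinset _ (List.nodup_finRange _), List.toFinset_finRange]
  simp [hz]
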